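/- **Proposition 4.2.** Let $N\ge 1$. For a unital $C^*$-algebra $A$ we write $A=C(X)$ and call $X$ a noncommutative compact space; an inclusion $X\subset Y$ means a surjective unital $*$-homomorphism $C(Y)\to C(X)$. The free complex sphere $S^{N-1}_{\mathbb C,+}$ is given by the universal unital $C^*$-algebra with generators $x_1,\dots,x_N$ and relations $\sum_i x_ix_i^*=\sum_i x_i^*x_i=1$. The spheres $S^{N-1}_{\mathbb C,**}$, $S^{N-1}_{\mathbb C,*}$, $S^{N-1}_{\mathbb C,\times}$ are obtained by adding, respectively, the relations: * $abc=cba$ for all $a,b,c\in\{x_i,x_i^*\}$; * the elements $ab^*$ and $a^*b$, with $a,b\in\{x_i\}$, all commute with each other; * $ab^*c=cb^*a$ for all $a,b,c\in\{x_i\}$. The full projective version $\mathcal PX$ of a subspace $X\subset S^{N-1}_{\mathbb C,+}$ is given by the $C^*$-subalgebra $C(\mathcal PX)\subset C(X)$ generated by the elements $x_ix_j^*$ and $x_j^*x_i$. Let $P^{N-1}_{\mathbb C}$ be the complex projective space, with coordinates $p_{ij}=z_i\bar z_j$ (where $z$ is a unit vector in the given line). Let $P^{N-1}_{\mathbb C}\circ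 P^{N-1}_{\mathbb C}$ be the noncommutative space given by the $C^*$-subalgebra of the full unital free product $C(P^{N-1}_{\mathbb C})*C(\mathbb T)$ generated by $C(P^{N-1}_{\mathbb C})$ and its conjugate $zC(P^{N-1}_{\mathbb C})z^*$, where $z$ is the standard unitary generator of $C(\mathbb T)$. Then there are inclusions $S^{N-1}_{\mathbb C,**}\subset S^{N-1}_{\mathbb C,*}\subset S^{N-1}_{\mathbb C,\times}$ (given by $x_i\mapsto x_i$), an inclusion $P^{N-1}_{\mathbb C}\times P^{N-1}_{\mathbb C}\subset P^{N-1}_{\mathbb C}\circ P^{N-1}_{\mathbb C}$ (given by $f\mapsto f\otimes 1$ and $zfz^*\mapsto 1\otimes f$, for $f\in C(P^{N-1}_{\mathbb C})$), and isomorphisms $$\mathcal PS^{N-1}_{\mathbb C,**}\simeq P^{N-1}_{\mathbb C}\times P^{N-1}_{\mathbb C},\qquad \mathcal PS^{N-1}_{\mathbb C,*}\simeq P^{N-1}_{\mathbb C}\times P^{N-1}_{\mathbb C},\qquad \mathcal PS^{N-1}_{\mathbb C,\times}\simeq P^{N-1}_{\mathbb C}\circ P^{N-1}_{\mathbb C},$$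 given by $x_ix_j^*\mapsto p_{ij}\otimes 1$ and $x_j^*x_i\mapsto 1\otimes p_{ij}$ in the first two cases, and by $x_ix_j^*\mapsto p_{ij}$ and $x_j^*x_i\mapsto zp_{ij}z^*$ in the third case. The resulting diagram $$\begin{array}{ccccc}S^{N-1}_{\mathbb C,**}&\to&S^{N-1}_{\mathbb C,*}&\to&S^{N-1}_{\mathbb C,\times}\\ \downarrow&&\downarrow&&\downarrow\\ P^{N-1}_{\mathbb C}\times P^{N-1}_{\mathbb C}&\to&P^{N-1}_{\mathbb C}\times P^{N-1}_{\mathbb C}&\to&P^{N-1}_{\mathbb C}\circ P^{N-1}_{\mathbb C}\end{array}$$ commutes, the lower left map being the identity. -/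

import Mathlib

open scoped LinearAlgebra.Projectivization

noncomputable section

namespace HalfClassical

/-! ### The free unital complex `*`-algebra on a set of generators -/

/-- The free unital complex `*`-algebra on `X`: noncommutative polynomials in letters `x` (the left
copy of `X`) and `x*` (the right copy of `X`). -/
def FreeStar (X : Type) : Type := FreeAlgebra ℂ (X ⊕ X)

namespace FreeStar

variable {X : Type}

instance : Ring (FreeStar X) := inferInstanceAs (Ring (FreeAlgebra ℂ (X ⊕ X)))

instance : Algebra ℂ (FreeStar X) := inferInstanceAs (Algebra ℂ (FreeAlgebra ℂ (X ⊕ X)))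

/-- The letters of the free `*`-algebra, `inl x` being `x` and `inr x` being `x*`. -/
def letter (y : X ⊕ X) : FreeStar X := FreeAlgebra.ι ℂ y

/-- The generator `x`. -/
def gen (x : X) : FreeStar X := letter (Sum.inl x)

/-- The opposite of the free `*`-algebra, with the conjugate action of the scalars. -/
def ConjOp (X : Type) : Type := (FreeStar X)ᵐᵒᵖ

instance : Ring (ConjOp X) := inferInstanceAs (Ring (FreeStar X)ᵐᵒᵖ)

instance : Algebra ℂ (ConjOp X) :=
  RingHom.toAlgebra'
    (((algebraMap ℂ (FreeStar X)).toOpposite (fun c _ => Algebra.commutes c _)).comp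
      (starRingEnd ℂ) : ℂ →+* (FreeStar X)ᵐᵒᵖ)
    (fun c x => MulOpposite.unop_injective
      (Algebra.commutes (starRingEnd ℂ c) (MulOpposite.unop (α := FreeStar X) x)).symm)

/-- The identity map to the conjugate opposite algebra. -/
def toConjOp (f : FreeStar X) : ConjOp X := MulOpposite.op f

/-- The identity map from the conjugate opposite algebra. -/
def ofConjOp (f : ConjOp X) : FreeStar X := MulOpposite.unop f

/-- The involution, as an algebra map into the conjugate opposite algebra: it reverses products,
conjugates scalars, and exchanges `x` with `x*`. -/
def starAux : FreeStar X →ₐ[ℂ] ConjOp X :=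
  FreeAlgebra.lift ℂ (fun y : X ⊕ X => toConjOp (letter y.swap))

instance : Star (FreeStar X) := ⟨fun f => ofConjOp (starAux f)⟩

theorem star_add' (f g : FreeStar X) : star (f + g) = star f + star g :=
  congrArg ofConjOp (map_add starAux f g)

theorem star_mul' (f g : FreeStar X) : star (f * g) = star g * star f :=
  congrArg ofConjOp (map_mul starAux f g)

theorem star_algebraMap' (c : ℂ) :
    star (algebraMap ℂ (FreeStar X) c) = algebraMap ℂ (FreeStar X) (star c) := by
  have h : starAux (algebraMap ℂ (FreeStar X) c) = algebraMap ℂ (ConjOp X) c :=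
    starAux.commutes c
  exact congrArg ofConjOp h

theorem star_letter (y : X ⊕ X) : star (letter y) = letter y.swap :=
  congrArg ofConjOp (FreeAlgebra.lift_ι_apply _ y)

theorem induct {C : FreeStar X → Prop} (h_scalar : ∀ c, C (algebraMap ℂ (FreeStar X) c))
    (h_letter : ∀ y, C (letter y)) (h_mul : ∀ a b, C a → C b → C (a * b))
    (h_add : ∀ a b, C a → C b → C (a + b)) (f : FreeStar X) : C f :=
  FreeAlgebra.induction ℂ (X ⊕ X) h_scalar h_letter h_mul h_add f

instance : StarRing (FreeStar X) where
  star_add := star_add'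
  star_mul := star_mul'
  star_involutive f := by
    induction f using induct with
    | h_scalar c => rw [star_algebraMap', star_algebraMap', star_star]
    | h_letter y => rw [star_letter, star_letter, Sum.swap_swap]
    | h_mul a b ha hb => rw [star_mul', star_mul', ha, hb]
    | h_add a b ha hb => rw [star_add', star_add', ha, hb]

instance : StarModule ℂ (FreeStar X) where
  star_smul c f := by
    rw [Algebra.smul_def, star_mul', star_algebraMap', ← Algebra.commutes, ← Algebra.smul_def]

/-- Evaluation of `*`-polynomials at a family of elements of a unital C⋆-algebra. -/
def eval {A : Type*} [CStarAlgebra A] (a : X → A) : FreeStar X →⋆ₐ[ℂ] A :=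
  { (FreeAlgebra.lift ℂ (Sum.elim a (fun x => star (a x))) : FreeStar X →ₐ[ℂ] A) with
    map_star' := fun f => by
      let φ : FreeStar X →ₐ[ℂ] A := FreeAlgebra.lift ℂ (Sum.elim a (fun x => star (a x)))
      have hl : ∀ y, φ (letter y) = Sum.elim a (fun x => star (a x)) y :=
        fun y => FreeAlgebra.lift_ι_apply _ y
      change φ (star f) = star (φ f)
      induction f using induct with
      | h_scalar c =>
        rw [star_algebraMap', AlgHom.commutes, AlgHom.commutes, algebraMap_star_comm]
      | h_letter y => rw [star_letter, hl, hl]; cases y <;> simp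
      | h_mul a b ha hb => rw [star_mul', map_mul, map_mul, ha, hb, star_mul]
      | h_add a b ha hb => rw [star_add', map_add, map_add, ha, hb, star_add] }

theorem eval_gen {A : Type*} [CStarAlgebra A] (a : X → A) (x : X) : eval a (gen x) = a x :=
  FreeAlgebra.lift_ι_apply _ (Sum.inl x)

end FreeStar

/-! ### Universal C⋆-algebras given by generators and relations -/

section Universal

variable {X : Type}

open FreeStar

/-- A family of elements of a C⋆-algebra satisfies the relations `r = 0`, for `r ∈ R`. -/
def Satisfies (R : Set (FreeStar X)) {A : Type*} [CStarAlgebra A] (a : X → A) : Prop :=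
  ∀ r ∈ R, eval a r = 0

/-- The relations bound the norms of the generators, so that the biggest C⋆-norm is finite. -/
class IsBounded (R : Set (FreeStar X)) : Prop where
  bound : ∀ x : X, ∃ C : ℝ, ∀ (A : Type) (_ : CStarAlgebra A) (a : X → A),
    Satisfies R a → ‖a x‖ ≤ C

/-- The norms of the values of `f` in all the C⋆-algebra representations of the relations `R`. -/
def normValues (R : Set (FreeStar X)) (f : FreeStar X) : Set ℝ :=
  {t | ∃ (A : Type) (_ : CStarAlgebra A) (a : X → A), Satisfies R a ∧ t = ‖eval a f‖}

theorem normValues_bddAbove (R : Set (FreeStar X)) [IsBounded R] (f : FreeStar X) :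
    BddAbove (normValues R f) := by
  have key : ∃ C : ℝ, 0 ≤ C ∧ ∀ (A : Type) (_ : CStarAlgebra A) (a : X → A),
      Satisfies R a → ‖eval a f‖ ≤ C := by
    induction f using induct with
    | h_scalar c =>
      refine ⟨‖c‖, norm_nonneg c, fun A _ a _ => ?_⟩
      rw [AlgHomClass.commutes]
      rcases subsingleton_or_nontrivial A with h | h
      · rw [Subsingleton.elim (algebraMap ℂ A c) 0, norm_zero]
        exact norm_nonneg c
      · rw [norm_algebraMap, CStarRing.norm_one, mul_one]
    | h_letter y =>
      cases y with
      | inl x =>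
        obtain ⟨C, hC⟩ := IsBounded.bound (R := R) x
        refine ⟨|C|, abs_nonneg C, fun A _ a ha => ?_⟩
        have h : eval a (letter (Sum.inl x)) = a x := eval_gen a x
        rw [h]
        exact (hC A _ a ha).trans (le_abs_self C)
      | inr x =>
        obtain ⟨C, hC⟩ := IsBounded.bound (R := R) x
        refine ⟨|C|, abs_nonneg C, fun A _ a ha => ?_⟩
        have h : letter (Sum.inr x) = star (gen x) := (star_letter (Sum.inl x)).symm
        rw [h, map_star, eval_gen, norm_star]
        exact (hC A _ a ha).trans (le_abs_self C)
    | h_mul f g hf hg =>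
      obtain ⟨C, hC0, hC⟩ := hf
      obtain ⟨D, hD0, hD⟩ := hg
      refine ⟨C * D, mul_nonneg hC0 hD0, fun A _ a ha => ?_⟩
      rw [map_mul]
      exact (norm_mul_le _ _).trans (mul_le_mul (hC A _ a ha) (hD A _ a ha) (norm_nonneg _) hC0)
    | h_add f g hf hg =>
      obtain ⟨C, hC0, hC⟩ := hf
      obtain ⟨D, hD0, hD⟩ := hg
      refine ⟨C + D, add_nonneg hC0 hD0, fun A _ a ha => ?_⟩
      rw [map_add]
      exact (norm_add_le _ _).trans (add_le_add (hC A _ a ha) (hD A _ a ha))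
  obtain ⟨C, -, hC⟩ := key
  refine ⟨C, ?_⟩
  rintro t ⟨A, inst, a, ha, rfl⟩
  exact hC A inst a ha

/-- The biggest C⋆-seminorm on `*`-polynomials, over all representations of the relations `R`. -/
def uNorm (R : Set (FreeStar X)) (f : FreeStar X) : ℝ := sSup (normValues R f)

theorem norm_eval_le (R : Set (FreeStar X)) [IsBounded R] {A : Type} [CStarAlgebra A] {a : X → A}
    (ha : Satisfies R a) (f : FreeStar X) : ‖eval a f‖ ≤ uNorm R f :=
  le_csSup (normValues_bddAbove R f) ⟨A, inferInstance, a, ha, rfl⟩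

theorem uNorm_le (R : Set (FreeStar X)) (f : FreeStar X) {C : ℝ} (hC : 0 ≤ C)
    (h : ∀ (A : Type) (_ : CStarAlgebra A) (a : X → A), Satisfies R a → ‖eval a f‖ ≤ C) :
    uNorm R f ≤ C := by
  refine Real.sSup_le ?_ hC
  rintro t ⟨A, inst, a, ha, rfl⟩
  exact h A inst a ha

theorem uNorm_nonneg (R : Set (FreeStar X)) (f : FreeStar X) : 0 ≤ uNorm R f := by
  refine Real.sSup_nonneg ?_
  rintro t ⟨A, inst, a, ha, rfl⟩
  exact norm_nonneg _

theorem uNorm_zero (R : Set (FreeStar X)) : uNorm R 0 = 0 :=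
  le_antisymm (uNorm_le R _ le_rfl fun A _ a _ => by rw [map_zero, norm_zero]) (uNorm_nonneg R _)

theorem uNorm_neg (R : Set (FreeStar X)) (f : FreeStar X) : uNorm R (-f) = uNorm R f := by
  simp only [uNorm, normValues, map_neg, norm_neg]

theorem uNorm_star (R : Set (FreeStar X)) (f : FreeStar X) : uNorm R (star f) = uNorm R f := by
  simp only [uNorm, normValues, map_star, norm_star]

theorem uNorm_add_le (R : Set (FreeStar X)) [IsBounded R] (f g : FreeStar X) :
    uNorm R (f + g) ≤ uNorm R f + uNorm R g :=
  uNorm_le R _ (add_nonneg (uNorm_nonneg R f) (uNorm_nonneg R g)) fun A _ a ha => by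
    rw [map_add]
    exact (norm_add_le _ _).trans (add_le_add (norm_eval_le R ha f) (norm_eval_le R ha g))

theorem uNorm_mul_le (R : Set (FreeStar X)) [IsBounded R] (f g : FreeStar X) :
    uNorm R (f * g) ≤ uNorm R f * uNorm R g :=
  uNorm_le R _ (mul_nonneg (uNorm_nonneg R f) (uNorm_nonneg R g)) fun A _ a ha => by
    rw [map_mul]
    exact (norm_mul_le _ _).trans (mul_le_mul (norm_eval_le R ha f) (norm_eval_le R ha g)
      (norm_nonneg _) (uNorm_nonneg R f))

theorem uNorm_smul_le (R : Set (FreeStar X)) [IsBounded R] (c : ℂ) (f : FreeStar X) :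
    uNorm R (c • f) ≤ ‖c‖ * uNorm R f :=
  uNorm_le R _ (mul_nonneg (norm_nonneg c) (uNorm_nonneg R f)) fun A _ a ha => by
    rw [map_smul, norm_smul]
    exact mul_le_mul_of_nonneg_left (norm_eval_le R ha f) (norm_nonneg c)

theorem uNorm_mul_self_le (R : Set (FreeStar X)) [IsBounded R] (f : FreeStar X) :
    uNorm R f * uNorm R f ≤ uNorm R (star f * f) := by
  have h : uNorm R f ≤ Real.sqrt (uNorm R (star f * f)) :=
    uNorm_le R _ (Real.sqrt_nonneg _) fun A _ a ha => by
      refine Real.le_sqrt_of_sq_le ?_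
      have h1 := norm_eval_le R ha (star f * f)
      rwa [map_mul, map_star, CStarRing.norm_star_mul_self, ← sq] at h1
  have h2 := mul_self_le_mul_self (uNorm_nonneg R f) h
  rwa [Real.mul_self_sqrt (uNorm_nonneg R _)] at h2

/-- The free `*`-algebra, equipped with the biggest C⋆-seminorm allowed by the relations `R`. -/
def Pre (R : Set (FreeStar X)) [IsBounded R] : Type :=
  FreeStar X

variable (R : Set (FreeStar X)) [IsBounded R]

instance : Ring (Pre R) := inferInstanceAs (Ring (FreeStar X))

instance : Algebra ℂ (Pre R) := inferInstanceAs (Algebra ℂ (FreeStar X))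

instance : StarRing (Pre R) := inferInstanceAs (StarRing (FreeStar X))

instance : StarModule ℂ (Pre R) := inferInstanceAs (StarModule ℂ (FreeStar X))

/-- The biggest C⋆-seminorm, as a ring seminorm. -/
def ringSeminorm : RingSeminorm (Pre R) where
  toFun := uNorm R
  map_zero' := uNorm_zero R
  add_le' := uNorm_add_le R
  neg' := uNorm_neg R
  mul_le' := uNorm_mul_le R

instance : SeminormedRing (Pre R) := (ringSeminorm R).toSeminormedRing

instance : NormedAlgebra ℂ (Pre R) where
  norm_smul_le := uNorm_smul_le R

theorem pre_norm_star (f : Pre R) : ‖star f‖ = ‖f‖ := uNorm_star R f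

theorem pre_norm_mul_self_le (f : Pre R) : ‖f‖ * ‖f‖ ≤ ‖star f * f‖ := uNorm_mul_self_le R f

/-- The universal unital C⋆-algebra on the generators `X`, subject to the relations `r = 0`, for
`r ∈ R`: the separation-completion of the free `*`-algebra for its biggest C⋆-seminorm. -/
def UnivCStar : Type := UniformSpace.Completion (Pre R)

instance : NormedRing (UnivCStar R) :=
  inferInstanceAs (NormedRing (UniformSpace.Completion (Pre R)))

instance : CompleteSpace (UnivCStar R) :=
  inferInstanceAs (CompleteSpace (UniformSpace.Completion (Pre R)))

instance : Algebra ℂ (UnivCStar R) :=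
  inferInstanceAs (Algebra ℂ (UniformSpace.Completion (Pre R)))

/-- The class of a `*`-polynomial in the universal C⋆-algebra. -/
def toUniv (f : FreeStar X) : UnivCStar R :=
  ((show Pre R from f : Pre R) : UniformSpace.Completion (Pre R))

theorem toUniv_add (f g : FreeStar X) : toUniv R (f + g) = toUniv R f + toUniv R g :=
  UniformSpace.Completion.coe_add (α := Pre R) f g

theorem toUniv_mul (f g : FreeStar X) : toUniv R (f * g) = toUniv R f * toUniv R g :=
  UniformSpace.Completion.coe_mul (α := Pre R) f g

theorem toUniv_algebraMap (c : ℂ) :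
    toUniv R (algebraMap ℂ (FreeStar X) c) = algebraMap ℂ (UnivCStar R) c := rfl

theorem norm_toUniv (f : FreeStar X) : ‖toUniv R f‖ = uNorm R f :=
  UniformSpace.Completion.norm_coe (E := Pre R) f

theorem univ_induction {p : UnivCStar R → Prop} (a : UnivCStar R) (hp : IsClosed {a | p a})
    (h : ∀ f, p (toUniv R f)) : p a :=
  UniformSpace.Completion.induction_on (α := Pre R) a hp h

theorem continuous_pre_star : UniformContinuous (star : Pre R → Pre R) :=
  (AddMonoidHomClass.isometry_of_norm (starAddEquiv : Pre R ≃+ Pre R)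
    (pre_norm_star R)).uniformContinuous

instance : Star (UnivCStar R) := ⟨UniformSpace.Completion.map (star : Pre R → Pre R)⟩

theorem univ_continuous_star : Continuous (star : UnivCStar R → UnivCStar R) :=
  UniformSpace.Completion.continuous_map

theorem toUniv_star (f : FreeStar X) : toUniv R (star f) = star (toUniv R f) :=
  (UniformSpace.Completion.map_coe (continuous_pre_star R) f).symm

theorem univ_induction₂ {p : UnivCStar R → UnivCStar R → Prop} (a b : UnivCStar R)
    (hp : IsClosed {x : UnivCStar R × UnivCStar R | p x.1 x.2})
    (h : ∀ f g, p (toUniv R f) (toUniv R g)) : p a b :=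
  UniformSpace.Completion.induction_on₂ (α := Pre R) (β := Pre R) a b hp h

instance : StarRing (UnivCStar R) where
  star_involutive a := by
    have hc := univ_continuous_star R
    refine univ_induction R (p := fun a => star (star a) = a) a
      (isClosed_eq (hc.comp hc) continuous_id) fun f => ?_
    rw [← toUniv_star, ← toUniv_star, star_star]
  star_mul a b := by
    have hc := univ_continuous_star R
    refine univ_induction₂ R (p := fun a b => star (a * b) = star b * star a) a b
      (isClosed_eq (by fun_prop) (by fun_prop)) fun f g => ?_
    rw [← toUniv_mul, ← toUniv_star, ← toUniv_star, ← toUniv_star, ← toUniv_mul, star_mul]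
  star_add a b := by
    have hc := univ_continuous_star R
    refine univ_induction₂ R (p := fun a b => star (a + b) = star a + star b) a b
      (isClosed_eq (by fun_prop) (by fun_prop)) fun f g => ?_
    rw [← toUniv_add, ← toUniv_star, ← toUniv_star, ← toUniv_star, ← toUniv_add, star_add]

instance : CStarAlgebra (UnivCStar R) where
  norm_smul_le c a := by
    refine univ_induction R (p := fun a => ‖c • a‖ ≤ ‖c‖ * ‖a‖) a ?_ fun f => ?_
    · simp only [Algebra.smul_def]
      exact isClosed_le (by fun_prop) (by fun_prop)
    rw [Algebra.smul_def, ← toUniv_algebraMap, ← toUniv_mul, ← Algebra.smul_def, norm_toUniv,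
      norm_toUniv]
    exact uNorm_smul_le R c f
  star_smul c a := by
    have hc := univ_continuous_star R
    refine univ_induction R (p := fun a => star (c • a) = star c • star a) a ?_ fun f => ?_
    · simp only [Algebra.smul_def]
      exact isClosed_eq (by fun_prop) (by fun_prop)
    rw [Algebra.smul_def, Algebra.smul_def, ← toUniv_algebraMap, ← toUniv_algebraMap,
      ← toUniv_mul, ← Algebra.smul_def, ← toUniv_star, ← toUniv_star, ← toUniv_mul,
      ← Algebra.smul_def, star_smul]
  norm_mul_self_le a := by
    have hc := univ_continuous_star R
    refine univ_induction R (p := fun a => ‖a‖ * ‖a‖ ≤ ‖star a * a‖) a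
      (isClosed_le (by fun_prop) (by fun_prop)) fun f => ?_
    rw [← toUniv_star, ← toUniv_mul, norm_toUniv, norm_toUniv]
    exact uNorm_mul_self_le R f

/-- The standard generators of the universal C⋆-algebra. -/
def univGen (x : X) : UnivCStar R := toUniv R (gen x)

end Universal

/-! ### Full free products of unital C⋆-algebras -/

section FreeProduct

open FreeStar

variable (A B : Type) [CStarAlgebra A] [CStarAlgebra B]

/-- The relations saying that `j` is a unital `*`-homomorphism. -/
def homRel {A X : Type} [CStarAlgebra A] (j : A → X) : Set (FreeStar X) :=
  {r | r = gen (j 1) - 1 ∨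
    (∃ a b, r = gen (j (a + b)) - (gen (j a) + gen (j b))) ∨
    (∃ a b, r = gen (j (a * b)) - gen (j a) * gen (j b)) ∨
    (∃ (c : ℂ) (a : A), r = gen (j (c • a)) - c • gen (j a)) ∨
    (∃ a, r = gen (j (star a)) - star (gen (j a)))}

/-- The relations defining the free product: the copies of `A` and of `B` sit in it through unital
`*`-homomorphisms, and no further relation is imposed. -/
def freeProdRel : Set (FreeStar (A ⊕ B)) :=
  homRel (Sum.inl : A → A ⊕ B) ∪ homRel (Sum.inr : B → A ⊕ B)

variable {A B} in
/-- A representation of the relations `homRel j` restricts to a `*`-homomorphism along `j`. -/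
def homOfRel {X C : Type} [CStarAlgebra C] (j : A → X) (a : X → C) (h : Satisfies (homRel j) a) :
    A →⋆ₐ[ℂ] C where
  toFun x := a (j x)
  map_one' := by
    have h1 := h _ (Or.inl rfl)
    rwa [map_sub, map_one, eval_gen, sub_eq_zero] at h1
  map_add' x y := by
    have h1 := h _ (Or.inr (Or.inl ⟨x, y, rfl⟩))
    rwa [map_sub, map_add, eval_gen, eval_gen, eval_gen, sub_eq_zero] at h1
  map_mul' x y := by
    have h1 := h _ (Or.inr (Or.inr (Or.inl ⟨x, y, rfl⟩)))
    rwa [map_sub, map_mul, eval_gen, eval_gen, eval_gen, sub_eq_zero] at h1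
  map_zero' := by
    have h1 := h _ (Or.inr (Or.inr (Or.inr (Or.inl ⟨0, 0, rfl⟩))))
    rwa [map_sub, map_smul, zero_smul, zero_smul, eval_gen, sub_zero] at h1
  commutes' c := by
    have h0 := h _ (Or.inl rfl)
    rw [map_sub, map_one, eval_gen, sub_eq_zero] at h0
    have h1 := h _ (Or.inr (Or.inr (Or.inr (Or.inl ⟨c, 1, rfl⟩))))
    rw [map_sub, map_smul, eval_gen, eval_gen, sub_eq_zero, h0] at h1
    rw [Algebra.algebraMap_eq_smul_one, Algebra.algebraMap_eq_smul_one, h1]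
  map_star' x := by
    have h1 := h _ (Or.inr (Or.inr (Or.inr (Or.inr ⟨x, rfl⟩))))
    rwa [map_sub, map_star, eval_gen, eval_gen, sub_eq_zero] at h1

instance : IsBounded (freeProdRel A B) where
  bound x := by
    cases x with
    | inl x =>
      exact ⟨‖x‖, fun C _ a ha => NonUnitalStarAlgHom.norm_apply_le
        (homOfRel Sum.inl a fun r hr => ha r (Or.inl hr)) x⟩
    | inr x =>
      exact ⟨‖x‖, fun C _ a ha => NonUnitalStarAlgHom.norm_apply_le
        (homOfRel Sum.inr a fun r hr => ha r (Or.inr hr)) x⟩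

/-- The full (universal) unital free product `A * B`. -/
abbrev FreeProd : Type := UnivCStar (freeProdRel A B)

variable {A B} in
/-- The canonical copy of `A` in `A * B`. -/
def freeInl (a : A) : FreeProd A B := univGen (freeProdRel A B) (Sum.inl a)

variable {A B} in
/-- The canonical copy of `B` in `A * B`. -/
def freeInr (b : B) : FreeProd A B := univGen (freeProdRel A B) (Sum.inr b)

end FreeProduct

section ConjugationProduct

variable (A : Type) [CStarAlgebra A]

/-- The standard free unitary `z` in `A * C(𝕋)`: the identity function of the unit circle. -/
def freeUnitary : FreeProd A C(Circle, ℂ) :=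
  freeInr (⟨fun w => (w : ℂ), continuous_subtype_val⟩ : C(Circle, ℂ))

variable {A} in
/-- The copy `z a z*` of the element `a ∈ A` in `A * C(𝕋)`, obtained by conjugating with the free
unitary `z`. -/
def freeConj (a : A) : FreeProd A C(Circle, ℂ) :=
  freeUnitary A * freeInl a * star (freeUnitary A)

/-- For `A = C(Y)`, the C⋆-algebra `C(Y ∘ Y)`: the C⋆-subalgebra of `A * C(𝕋)` generated by `A` and
by its conjugate `z A z*` by the free unitary `z`. -/
def circProd : StarSubalgebra ℂ (FreeProd A C(Circle, ℂ)) :=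
  (StarAlgebra.adjoin ℂ (Set.range freeInl ∪ Set.range freeConj)).topologicalClosure

variable {A}

/-- The first copy of `A` in `C(Y ∘ Y)`, namely `A` itself. -/
def circFst (a : A) : circProd A :=
  ⟨freeInl a, StarSubalgebra.le_topologicalClosure _
    (StarAlgebra.subset_adjoin ℂ _ (Or.inl ⟨a, rfl⟩))⟩

/-- The second copy of `A` in `C(Y ∘ Y)`, namely `z A z*`. -/
def circSnd (a : A) : circProd A :=
  ⟨freeConj a, StarSubalgebra.le_topologicalClosure _
    (StarAlgebra.subset_adjoin ℂ _ (Or.inr ⟨a, rfl⟩))⟩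

end ConjugationProduct

/-! ### Noncommutative spheres and their full projective versions -/

section Spheres

open FreeStar

variable (N : ℕ)

/-- The relations `∑ xᵢ xᵢ* = 1` and `∑ xᵢ* xᵢ = 1` defining the free complex sphere. -/
def freeSphereRel : Set (FreeStar (Fin N)) :=
  {∑ i, gen i * star (gen i) - 1, ∑ i, star (gen i) * gen i - 1}

instance (T : Set (FreeStar (Fin N))) : IsBounded (freeSphereRel N ∪ T) where
  bound i := by
    refine ⟨1, fun A _ a ha => ?_⟩
    have h := ha _ (Or.inl (Or.inl rfl))
    simp only [map_sub, map_sum, map_mul, map_star, eval_gen, map_one, sub_eq_zero] at h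
    let _ := CStarAlgebra.spectralOrder A
    have := CStarAlgebra.spectralOrderedRing A
    have h1 : a i * star (a i) ≤ 1 := by
      rw [← h]
      exact Finset.single_le_sum (f := fun i => a i * star (a i))
        (fun j _ => mul_star_self_nonneg (a j)) (Finset.mem_univ i)
    have h2 : ‖a i‖ * ‖a i‖ ≤ ‖(1 : A)‖ := by
      rw [← CStarRing.norm_self_mul_star]
      exact CStarAlgebra.norm_le_norm_of_nonneg_of_le (mul_star_self_nonneg _) h1
    have h3 : ‖(1 : A)‖ ≤ 1 := by
      rcases subsingleton_or_nontrivial A with h' | h'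
      · rw [Subsingleton.elim (1 : A) 0, norm_zero]
        exact zero_le_one
      · exact CStarRing.norm_one.le
    nlinarith [norm_nonneg (a i)]

variable {N}

/-- The C⋆-algebra `C(X)` of the subspace `X` of the free complex sphere cut out by the relations
`r = 0`, for `r ∈ T`. -/
abbrev SphereAlg (T : Set (FreeStar (Fin N))) : Type := UnivCStar (freeSphereRel N ∪ T)

/-- The standard coordinates `xᵢ` on such a subspace. -/
def coord (T : Set (FreeStar (Fin N))) (i : Fin N) : SphereAlg T :=
  univGen (freeSphereRel N ∪ T) i

/-- The coordinates `pᵢⱼ = xᵢ xⱼ*` on the left projective version. -/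
def leftCoord (T : Set (FreeStar (Fin N))) (i j : Fin N) : SphereAlg T :=
  coord T i * star (coord T j)

/-- The coordinates `qᵢⱼ = xⱼ* xᵢ` on the right projective version. -/
def rightCoord (T : Set (FreeStar (Fin N))) (i j : Fin N) : SphereAlg T :=
  star (coord T j) * coord T i

/-- The C⋆-algebra of the full projective version of a subspace `X` of the free complex sphere: the
C⋆-subalgebra of `C(X)` generated by the variables `pᵢⱼ` and `qᵢⱼ`. -/
def fullProj (T : Set (FreeStar (Fin N))) : StarSubalgebra ℂ (SphereAlg T) :=
  (StarAlgebra.adjoin ℂ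
    ({f | ∃ i j, f = leftCoord T i j} ∪ {f | ∃ i j, f = rightCoord T i j})).topologicalClosure

/-- `pᵢⱼ`, as an element of the algebra of the full projective version. -/
def fullP (T : Set (FreeStar (Fin N))) (i j : Fin N) : fullProj T :=
  ⟨leftCoord T i j, StarSubalgebra.le_topologicalClosure _
    (StarAlgebra.subset_adjoin ℂ _ (Or.inl ⟨i, j, rfl⟩))⟩

/-- `qᵢⱼ`, as an element of the algebra of the full projective version. -/
def fullQ (T : Set (FreeStar (Fin N))) (i j : Fin N) : fullProj T :=
  ⟨rightCoord T i j, StarSubalgebra.le_topologicalClosure _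
    (StarAlgebra.subset_adjoin ℂ _ (Or.inr ⟨i, j, rfl⟩))⟩

variable (N)

/-- The relations `abc = cba`, with `a, b, c` among the `xᵢ` and the `xᵢ*`, defining the sphere
`S_{ℂ,**}`. -/
def relStarStar : Set (FreeStar (Fin N)) :=
  {r | ∃ a b c : Fin N ⊕ Fin N,
    r = letter a * letter b * letter c - letter c * letter b * letter a}

/-- The elements `ab*` and `a*b`, with `a, b` among the `xᵢ`. -/
def projWords : Set (FreeStar (Fin N)) :=
  {f | ∃ i j, f = gen i * star (gen j)} ∪ {f | ∃ i j, f = star (gen i) * gen j}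

/-- The relations saying that the variables `ab*` and `a*b` all commute, with `a, b` among the `xᵢ`,
defining the sphere `S_{ℂ,*}`. -/
def relStar : Set (FreeStar (Fin N)) :=
  {r | ∃ f ∈ projWords N, ∃ g ∈ projWords N, r = f * g - g * f}

/-- The relations `ab*c = cb*a`, with `a, b, c` among the `xᵢ`, defining the sphere `S_{ℂ,×}`. -/
def relTimes : Set (FreeStar (Fin N)) :=
  {r | ∃ i j k : Fin N,
    r = gen i * star (gen j) * gen k - gen k * star (gen j) * gen i}

end Spheres

/-! ### The complex projective space -/

section ProjectiveSpace

variable (N : ℕ)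

/-- The complex projective space: the lines of `ℂᴺ`. -/
abbrev CP : Type := ℙ ℂ (EuclideanSpace ℂ (Fin N))

/-- The quotient topology on the projective space. -/
instance : TopologicalSpace (CP N) :=
  inferInstanceAs (TopologicalSpace (Quotient
    (projectivizationSetoid ℂ (EuclideanSpace ℂ (Fin N)))))

instance : CompactSpace (CP N) := by
  let φ : Metric.sphere (0 : EuclideanSpace ℂ (Fin N)) 1 → CP N :=
    fun v => Projectivization.mk' ℂ ⟨v, ne_zero_of_mem_unit_sphere v⟩
  have hφ : Continuous φ :=
    continuous_quotient_mk'.comp (continuous_subtype_val.subtype_mk _)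
  have hs : Function.Surjective φ := by
    intro l
    induction l using Projectivization.ind with
    | h v hv =>
      have hn : ‖v‖ ≠ 0 := norm_ne_zero_iff.mpr hv
      refine ⟨⟨((‖v‖⁻¹ : ℝ) : ℂ) • v, ?_⟩, ?_⟩
      · rw [mem_sphere_zero_iff_norm, norm_smul, Complex.norm_real, norm_inv, norm_norm,
          inv_mul_cancel₀ hn]
      · refine (Projectivization.mk_eq_mk_iff' ℂ _ _ _ _).mpr ⟨((‖v‖⁻¹ : ℝ) : ℂ), rfl⟩
  exact hs.compactSpace hφ

variable {N}

/-- The standard coordinates `pᵢⱼ = zᵢ z̄ⱼ` on the projective space, where `z` is any unit vector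
spanning the given line; for an arbitrary spanning vector `v` this is `vᵢ v̄ⱼ / ‖v‖²`. -/
def projCoord (i j : Fin N) : C(CP N, ℂ) where
  toFun := Projectivization.lift
    (fun v : { v : EuclideanSpace ℂ (Fin N) // v ≠ 0 } =>
      v.1 i * star (v.1 j) / ((‖v.1‖ : ℂ) ^ 2))
    (by
      rintro ⟨v, hv⟩ ⟨w, hw⟩ t h
      have h' : v = t • w := h
      subst h'
      have ht : t ≠ 0 := fun h0 => hv (by rw [h0, zero_smul])
      have hw' : (‖w‖ : ℂ) ≠ 0 := Complex.ofReal_ne_zero.mpr (norm_ne_zero_iff.mpr hw)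
      have ht' : (‖t‖ : ℂ) ≠ 0 := Complex.ofReal_ne_zero.mpr (norm_ne_zero_iff.mpr ht)
      have hs : t * star t = (‖t‖ : ℂ) ^ 2 := Complex.mul_conj' t
      simp only [PiLp.smul_apply, smul_eq_mul, star_mul', norm_smul, Complex.ofReal_mul, mul_pow]
      rw [← hs]
      have ht2 : t * star t ≠ 0 := by rw [hs]; exact pow_ne_zero 2 ht'
      rw [div_eq_div_iff (mul_ne_zero ht2 (pow_ne_zero 2 hw')) (pow_ne_zero 2 hw')]
      ring)
  continuous_toFun := by
    refine Continuous.quotient_lift ?_ _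
    refine Continuous.div (by fun_prop) (by fun_prop) fun v => ?_
    exact pow_ne_zero 2 (Complex.ofReal_ne_zero.mpr (norm_ne_zero_iff.mpr v.2))

/-- The function `f ⊗ 1` on the product of two spaces. -/
def tensorLeft {Y Z : Type} [TopologicalSpace Y] [TopologicalSpace Z] (f : C(Y, ℂ)) : C(Y × Z, ℂ) :=
  f.comp ContinuousMap.fst

/-- The function `1 ⊗ f` on the product of two spaces. -/
def tensorRight {Y Z : Type} [TopologicalSpace Y] [TopologicalSpace Z] (f : C(Z, ℂ)) :
    C(Y × Z, ℂ) :=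
  f.comp ContinuousMap.snd

end ProjectiveSpace

end HalfClassical

end

/-!
The universal properties of the algebras involved give all the homomorphisms.

* `C(P)` is the universal C⋆-algebra generated by the commuting entries of a projection of rank one,
  and `C(P × P)` by those of two commuting ones. By Gelfand duality (`exists_continuousMap_lift`),
  this says that the rank one projections in `M_N(ℂ)` are the points of `P` (`exists_point`).
* Any two representations `φ`, `ψ` of `A = C(Y)` in the same algebra give one of `C(Y ∘ Y)`, with
  `f ↦ φ f` and `zfz* ↦ ψ f` (`exists_circProd_lift`): the flip conjugates `diag(φ f, ψ f)` to
  `diag(ψ f, φ f)`, and one takes a corner of these `2 × 2` matrices. This gives `P × P ⊂ P ∘ P`.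
* In `C(S_{ℂ,×})` the relations `ab*c = cb*a` make the `xᵢxⱼ*`, and the `xⱼ*xᵢ`, into the entries of
  rank one projections, whence a homomorphism from `C(P ∘ P)` onto the algebra of the projective
  version.
* In `C(S_{ℂ,*})`, which is a quotient of `C(S_{ℂ,×})` by `isTimesSphere_of_star`, these two
  projections commute, whence a homomorphism from `C(P × P)`, and similarly for `S_{ℂ,**}`.

It remains to see that these homomorphisms are injective. For `S_{ℂ,**}` and `S_{ℂ,*}`, two unit
vectors `v` and `w` give a representation of `C(S_{ℂ,**})` by the matrices with antidiagonal entries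
`vᵢ` and `wᵢ`, whose corner is a character over the corresponding point of `P × P`.

For `S_{ℂ,×}`, the inverse homomorphism must realize `pᵢⱼ` as `xᵢxⱼ*` and `zpᵢⱼz*` as `xⱼ*xᵢ`, in
terms of `C(P) * C(𝕋)`. Over the sphere `xᵢ = zᵢz*` would do, but the coordinates `zᵢ` are not
functions on `P`: they are sections of a line bundle `L`. They act, however, on a direct sum of
bundles, as `zᵢ : 0 → L`, `zᵢ : L⁻¹ → 0`, `z̄ᵢ : 0' → L⁻¹` and `z̄ᵢ : L → 0'`, where `0` and `0'` are
trivial, and the bundles reached are the bundles left. As `L` and `L⁻¹` lie in trivial bundles, these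
are matrices over `C(P)`, and after multiplication by the adjoint of `diag(z, 1, …, 1)` the corner at
`0` is the desired homomorphism (`IsRankOne.exists_timesSphere`).
-/

noncomputable section

namespace HalfClassical

/-! ### Star homomorphisms of C⋆-algebras -/

section Closure

variable {A B : Type*} [CStarAlgebra A] [CStarAlgebra B]

theorem continuous_starAlgHom (φ : A →⋆ₐ[ℂ] B) :
    Continuous φ :=
  AddMonoidHomClass.continuous_of_bound φ 1 fun a => by
    rw [one_mul]; exact NonUnitalStarAlgHom.norm_apply_le φ a

/-- A self-adjoint element can be truncated, without changing its image, to the norm of the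
image. -/
theorem exists_selfAdjoint_lift (φ : A →⋆ₐ[ℂ] B) {a : A} (ha : IsSelfAdjoint a) :
    ∃ a', φ a' = φ a ∧ ‖a'‖ ≤ ‖φ a‖ := by
  let t := ‖φ a‖
  have ht : 0 ≤ t := norm_nonneg _
  let f : ℝ → ℝ := fun x => max (-t) (min x t)
  have hf : Continuous f := by fun_prop
  have hφ : Continuous φ := continuous_starAlgHom φ
  refine ⟨cfc f a, ?_, ?_⟩
  · rw [StarAlgHomClass.map_cfc φ f a hf.continuousOn hφ ha (ha.map φ)]
    conv_rhs => rw [← cfc_id ℝ (φ a) (ha.map φ)]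
    refine cfc_congr fun x hx => ?_
    have hx' : |x| ≤ t := by
      rcases subsingleton_or_nontrivial B with h | h
      · simp [spectrum.of_subsingleton] at hx
      · exact spectrum.norm_le_norm_of_mem hx
    rw [abs_le] at hx'
    simp only [f, id, min_eq_left hx'.2, max_eq_right hx'.1]
  · refine norm_cfc_le ht fun x _ => ?_
    rw [Real.norm_eq_abs, abs_le]
    exact ⟨le_max_left _ _, max_le (by linarith) (min_le_right _ _)⟩

/-- The range of a star homomorphism of C⋆-algebras is closed: by truncating real and imaginary
parts, each of its elements `b` has a preimage of norm at most `2‖b‖`. -/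
theorem isClosed_range_starAlgHom (φ : A →⋆ₐ[ℂ] B) : IsClosed (Set.range φ) := by
  let f : NormedAddGroupHom A B := AddMonoidHom.mkNormedAddGroupHom
    (φ.toAlgHom.toLinearMap.toAddMonoidHom) 1
    (fun a => by rw [one_mul]; exact NonUnitalStarAlgHom.norm_apply_le φ a)
  have hf : ∀ a, f a = φ a := fun _ => rfl
  have hr : f.range.topologicalClosure = f.range := by
    refine le_antisymm ?_ (AddSubgroup.le_topologicalClosure _)
    have key : f.SurjectiveOnWith f.range 2 := by
      rintro b ⟨a, rfl⟩
      obtain ⟨u, hu, hu'⟩ := exists_selfAdjoint_lift φ (realPart a).2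
      obtain ⟨v, hv, hv'⟩ := exists_selfAdjoint_lift φ (imaginaryPart a).2
      have h1 : φ (realPart a : A) = (realPart (φ a) : B) := by
        rw [realPart_apply_coe, realPart_apply_coe, map_real_smul φ (continuous_starAlgHom φ),
          map_add, map_star]
      have h2 : φ (imaginaryPart a : A) = (imaginaryPart (φ a) : B) := by
        rw [imaginaryPart_apply_coe, imaginaryPart_apply_coe, map_smul,
          map_real_smul φ (continuous_starAlgHom φ), map_sub, map_star]
      refine ⟨u + Complex.I • v, ?_, ?_⟩
      · change φ _ = φ a
        rw [map_add, map_smul, hu, hv, ← map_smul, ← map_add, realPart_add_I_smul_imaginaryPart]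
      · have h3 := realPart.norm_le (φ a)
        have h4 := imaginaryPart.norm_le (φ a)
        have h3' : ‖(realPart (φ a) : B)‖ ≤ ‖φ a‖ := h3
        have h4' : ‖(imaginaryPart (φ a) : B)‖ ≤ ‖φ a‖ := h4
        rw [h1] at hu'
        rw [h2] at hv'
        refine (norm_add_le _ _).trans ?_
        rw [norm_smul, Complex.norm_I, one_mul]
        change _ ≤ 2 * ‖φ a‖
        linarith
    intro b hb
    obtain ⟨a, ha, -⟩ := controlled_closure_of_complete (ε := 1) two_pos one_pos key b hb
    exact ⟨a, ha⟩
  have : (Set.range φ) = (f.range.topologicalClosure : Set B) := by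
    rw [hr]; rfl
  rw [this]
  exact AddSubgroup.isClosed_topologicalClosure _

theorem closureAdjoin_ext {s : Set A}
    {φ ψ : (StarAlgebra.adjoin ℂ s).topologicalClosure →⋆ₐ[ℂ] B}
    (h : ∀ x ∈ s, ∀ (hx' : x ∈ (StarAlgebra.adjoin ℂ s).topologicalClosure),
      φ ⟨x, hx'⟩ = ψ ⟨x, hx'⟩) : φ = ψ := by
  have := (StarAlgebra.adjoin ℂ s).isClosed_topologicalClosure
  refine StarAlgHom.ext_topologicalClosure (continuous_starAlgHom φ) (continuous_starAlgHom ψ) ?_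
  refine StarAlgHom.ext_adjoin fun x hx => ?_
  exact h x hx _

theorem map_mem_closureAdjoin {s : Set A} (φ : A →⋆ₐ[ℂ] B) {S : StarSubalgebra ℂ B}
    (hS : IsClosed (S : Set B)) (h : ∀ x ∈ s, φ x ∈ S) {x : A}
    (hx : x ∈ (StarAlgebra.adjoin ℂ s).topologicalClosure) : φ x ∈ S := by
  have h1 : (StarAlgebra.adjoin ℂ s).topologicalClosure ≤ S.comap φ :=
    StarSubalgebra.topologicalClosure_minimal (StarAlgebra.adjoin_le fun x hx => h x hx)
      (hS.preimage (continuous_starAlgHom φ))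
  exact h1 hx

theorem closureAdjoin_le_range {s : Set B} (φ : A →⋆ₐ[ℂ] B) (h : s ⊆ Set.range φ) {x : B}
    (hx : x ∈ (StarAlgebra.adjoin ℂ s).topologicalClosure) : ∃ a, φ a = x := by
  have h1 : (StarAlgebra.adjoin ℂ s).topologicalClosure ≤ φ.range :=
    StarSubalgebra.topologicalClosure_minimal (StarAlgebra.adjoin_le fun x hx => h hx)
      (isClosed_range_starAlgHom φ)
  exact h1 hx

theorem closureAdjoin_surjective {s : Set B}
    (φ : A →⋆ₐ[ℂ] (StarAlgebra.adjoin ℂ s).topologicalClosure)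
    (h : ∀ x ∈ s, ∃ a, (φ a : B) = x) : Function.Surjective φ := by
  rintro ⟨x, hx⟩
  obtain ⟨a, ha⟩ := closureAdjoin_le_range ((StarSubalgebra.subtype _).comp φ) h hx
  exact ⟨a, Subtype.ext ha⟩

end Closure

/-! ### The universal property of the C⋆-algebra of a set of relations -/

section General

open FreeStar

variable {X : Type} (R : Set (FreeStar X)) [IsBounded R]

/-- A family satisfying the relations is the image of the generators: evaluation of `*`-polynomials
is contractive for the biggest C⋆-seminorm, and extends to the completion. -/
theorem exists_univ_lift {A : Type} [CStarAlgebra A] (a : X → A) (ha : Satisfies R a) :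
    ∃ φ : UnivCStar R →⋆ₐ[ℂ] A, ∀ x, φ (univGen R x) = a x := by
  let e : Pre R →+ A := (eval a : FreeStar X →⋆ₐ[ℂ] A).toAlgHom.toLinearMap.toAddMonoidHom
  have hec : UniformContinuous e :=
    uniformContinuous_addMonoidHom_of_continuous
      (AddMonoidHomClass.continuous_of_bound e 1 fun f => by
        rw [one_mul]; exact norm_eval_le R ha f)
  let F : UnivCStar R → A := UniformSpace.Completion.extension e
  have hF : ∀ f, F (toUniv R f) = eval a f := fun f =>
    UniformSpace.Completion.extension_coe hec f
  have hFc : Continuous F := UniformSpace.Completion.continuous_extension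
  have hs := univ_continuous_star R
  let φ : UnivCStar R →⋆ₐ[ℂ] A :=
    { toFun := F
      map_one' := (hF 1).trans (map_one _)
      map_zero' := (hF 0).trans (map_zero _)
      map_mul' := fun x y => by
        refine univ_induction₂ R (p := fun x y => F (x * y) = F x * F y) x y
          (isClosed_eq (by fun_prop) (by fun_prop)) fun f g => ?_
        rw [← toUniv_mul, hF, hF, hF, map_mul]
      map_add' := fun x y => by
        refine univ_induction₂ R (p := fun x y => F (x + y) = F x + F y) x y
          (isClosed_eq (by fun_prop) (by fun_prop)) fun f g => ?_
        rw [← toUniv_add, hF, hF, hF, map_add]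
      commutes' := fun c => by
        rw [← toUniv_algebraMap]
        exact (hF _).trans (AlgHomClass.commutes _ c)
      map_star' := fun x => by
        refine univ_induction R (p := fun x => F (star x) = star (F x)) x
          (isClosed_eq (by fun_prop) (by fun_prop)) fun f => ?_
        rw [← toUniv_star, hF, hF, map_star] }
  exact ⟨φ, fun x => (hF (gen x)).trans (eval_gen a x)⟩

theorem map_toUniv {A : Type} [CStarAlgebra A] (φ : UnivCStar R →⋆ₐ[ℂ] A) (f : FreeStar X) :
    φ (toUniv R f) = eval (fun x => φ (univGen R x)) f := by
  have hl : ∀ x, eval (fun x => φ (univGen R x)) (letter (Sum.inl x)) = φ (univGen R x) :=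
    fun x => eval_gen _ x
  induction f using induct with
  | h_scalar c => rw [toUniv_algebraMap, AlgHomClass.commutes, AlgHomClass.commutes]
  | h_letter y =>
    cases y with
    | inl x => exact (hl x).symm
    | inr x =>
      have h : letter (Sum.inr x) = star (gen x) := (star_letter (Sum.inl x)).symm
      rw [h, toUniv_star, map_star, map_star, eval_gen]
      rfl
  | h_mul f g hf hg => rw [toUniv_mul, map_mul, map_mul, hf, hg]
  | h_add f g hf hg => rw [toUniv_add, map_add, map_add, hf, hg]

theorem satisfies_univGen : Satisfies R (univGen R) := fun r hr => by
  have h := map_toUniv R (StarAlgHom.id ℂ (UnivCStar R)) r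
  simp only [StarAlgHom.coe_id, id] at h
  rw [← h, ← norm_eq_zero, norm_toUniv]
  exact le_antisymm (uNorm_le R r le_rfl fun A _ a ha => by rw [ha r hr, norm_zero])
    (uNorm_nonneg R r)

theorem univ_surjective {A : Type} [CStarAlgebra A] (φ : A →⋆ₐ[ℂ] UnivCStar R)
    (h : ∀ x, univGen R x ∈ Set.range φ) : Function.Surjective φ := by
  intro b
  refine univ_induction R (p := fun b => b ∈ Set.range φ) b (isClosed_range_starAlgHom φ)
    fun f => ?_
  change toUniv R f ∈ φ.range
  induction f using induct with
  | h_scalar c => exact φ.range.algebraMap_mem c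
  | h_letter y =>
    cases y with
    | inl x => exact h x
    | inr x =>
      have h' : letter (Sum.inr x) = star (gen x) := (star_letter (Sum.inl x)).symm
      rw [h', toUniv_star]
      exact star_mem (h x)
  | h_mul f g hf hg => rw [toUniv_mul]; exact mul_mem hf hg
  | h_add f g hf hg => rw [toUniv_add]; exact add_mem hf hg

end General

/-! ### Corners of matrix algebras -/

section Corner

/-- Matrices over a C⋆-algebra, as a C⋆-algebra; the order of the entries, which Mathlib's instance
takes as a parameter, is the spectral one. -/
instance matrixCStarAlgebra {ι A : Type*} [Fintype ι] [DecidableEq ι] [CStarAlgebra A] :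
    CStarAlgebra (CStarMatrix ι ι A) :=
  letI := CStarAlgebra.spectralOrder A
  haveI := CStarAlgebra.spectralOrderedRing A
  CStarMatrix.instCStarAlgebra

variable {ι A D : Type*} [Fintype ι] [DecidableEq ι] [CStarAlgebra A] [CStarAlgebra D]

/-- The matrices which are the direct sum of their `(i₀, i₀)` entry and of a matrix on the other
indices. -/
def splitMatrices (A : Type*) [CStarAlgebra A] (i₀ : ι) : StarSubalgebra ℂ (CStarMatrix ι ι A) where
  carrier := {M | ∀ k, k ≠ i₀ → M i₀ k = 0 ∧ M k i₀ = 0}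
  mul_mem' {M N} hM hN k hk := by
    simp only [CStarMatrix.mul_apply]
    constructor <;> refine Finset.sum_eq_zero fun j _ => ?_ <;>
      rcases eq_or_ne j i₀ with rfl | hj
    · rw [(hN k hk).1, mul_zero]
    · rw [(hM j hj).1, zero_mul]
    · rw [(hM k hk).2, zero_mul]
    · rw [(hN j hj).2, mul_zero]
  add_mem' {M N} hM hN k hk := by
    simp only [CStarMatrix.add_apply]
    rw [(hM k hk).1, (hM k hk).2, (hN k hk).1, (hN k hk).2, add_zero]
    exact ⟨rfl, rfl⟩
  algebraMap_mem' c k hk := by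
    simp only [CStarMatrix.algebraMap_apply, if_neg hk, if_neg hk.symm, and_self]
  star_mem' {M} hM k hk := by
    simp only [CStarMatrix.star_apply, (hM k hk).1, (hM k hk).2, star_zero, and_self]

theorem isClosed_splitMatrices (i₀ : ι) :
    IsClosed (splitMatrices A i₀ : Set (CStarMatrix ι ι A)) := by
  have hc : ∀ i j, Continuous fun M : CStarMatrix ι ι A => M i j := fun i j =>
    (continuous_apply j).comp (continuous_apply (A := fun _ => ι → A) i)
  have : (splitMatrices A i₀ : Set (CStarMatrix ι ι A)) =
      ⋂ k, ⋂ (_ : k ≠ i₀), {M | M i₀ k = 0} ∩ {M | M k i₀ = 0} := by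
    ext M
    simp only [Set.mem_iInter]
    rfl
  rw [this]
  exact isClosed_iInter fun k => isClosed_iInter fun _ =>
    (isClosed_eq (hc _ _) continuous_const).inter (isClosed_eq (hc _ _) continuous_const)

/-- The corner `M ↦ M i₀ i₀`, multiplicative on the matrices split at `i₀`. -/
def corner (A : Type*) [CStarAlgebra A] (i₀ : ι) : splitMatrices A i₀ →⋆ₐ[ℂ] A where
  toFun M := (M : CStarMatrix ι ι A) i₀ i₀
  map_one' := CStarMatrix.one_apply_eq _
  map_mul' M N := by
    change ((M : CStarMatrix ι ι A) * (N : CStarMatrix ι ι A)) i₀ i₀ = _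
    rw [CStarMatrix.mul_apply]
    refine Finset.sum_eq_single i₀ (fun j _ hj => ?_) fun h => (h (Finset.mem_univ _)).elim
    rw [(M.2 j hj).1, zero_mul]
  map_zero' := rfl
  map_add' _ _ := rfl
  commutes' c := by
    change (algebraMap ℂ (CStarMatrix ι ι A) c) i₀ i₀ = _
    rw [CStarMatrix.algebraMap_apply, if_pos rfl]
  map_star' _ := rfl

/-- If a star homomorphism into matrices splits at `i₀` on a set `s`, then its `(i₀, i₀)` entry is
a star homomorphism on the C⋆-algebra generated by `s`. -/
theorem exists_corner (φ : D →⋆ₐ[ℂ] CStarMatrix ι ι A) (i₀ : ι) {s : Set D}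
    (h : ∀ x ∈ s, ∀ k, k ≠ i₀ → φ x i₀ k = 0 ∧ φ x k i₀ = 0) :
    ∃ θ : (StarAlgebra.adjoin ℂ s).topologicalClosure →⋆ₐ[ℂ] A, ∀ x, θ x = φ x i₀ i₀ := by
  have hm : ∀ x : (StarAlgebra.adjoin ℂ s).topologicalClosure,
      φ.comp (StarSubalgebra.subtype _) x ∈ splitMatrices A i₀ := fun x =>
    map_mem_closureAdjoin φ (isClosed_splitMatrices i₀) h x.2
  exact ⟨(corner A i₀).comp ((φ.comp (StarSubalgebra.subtype _)).codRestrict _ hm), fun _ => rfl⟩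

end Corner

/-! ### The universal property of the algebra of functions on a compact space -/

section Commutative

variable {ι Y A : Type*} [TopologicalSpace Y] [CompactSpace Y] [CStarAlgebra A]

theorem adjoin_range_dense {f : ι → C(Y, ℂ)} (hf : ∀ x y, (∀ i, f i x = f i y) → x = y) :
    (StarAlgebra.adjoin ℂ (Set.range f)).topologicalClosure = ⊤ := by
  refine ContinuousMap.starSubalgebra_topologicalClosure_eq_top_of_separatesPoints _ ?_
  intro x y hxy
  have : ∃ i, f i x ≠ f i y := by
    by_contra! h
    exact hxy (hf x y h)
  obtain ⟨i, hi⟩ := this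
  exact ⟨f i, ⟨f i, StarAlgebra.subset_adjoin ℂ _ ⟨i, rfl⟩, rfl⟩, hi⟩

/-- Star homomorphisms from `C(Y)` agree when they do on a point-separating family (Stone and
Weierstrass). -/
theorem continuousMap_hom_ext {f : ι → C(Y, ℂ)} (hf : ∀ x y, (∀ i, f i x = f i y) → x = y)
    {φ ψ : C(Y, ℂ) →⋆ₐ[ℂ] A} (h : ∀ i, φ (f i) = ψ (f i)) : φ = ψ := by
  ext g
  have hg : g ∈ (StarAlgebra.adjoin ℂ (Set.range f)).topologicalClosure := by
    rw [adjoin_range_dense hf]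
    exact StarSubalgebra.mem_top
  have h1 : (StarAlgebra.adjoin ℂ (Set.range f)).topologicalClosure ≤
      StarAlgHom.equalizer φ ψ := by
    refine StarSubalgebra.topologicalClosure_minimal (StarAlgebra.adjoin_le ?_)
      (isClosed_eq (continuous_starAlgHom φ) (continuous_starAlgHom ψ))
    rintro _ ⟨i, rfl⟩
    exact h i
  exact h1 hg

theorem closureAdjoin_mul_comm {s : Set A} (hc : ∀ x ∈ s, ∀ y ∈ s, x * y = y * x)
    (hc' : ∀ x ∈ s, ∀ y ∈ s, x * star y = star y * x) :
    ∀ x y : (StarAlgebra.adjoin ℂ s).topologicalClosure, x * y = y * x := by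
  have h0 := StarAlgebra.isMulCommutative_adjoin ℂ hc hc'
  have h1 : ∀ x y : StarAlgebra.adjoin ℂ s, x * y = y * x := fun x y => h0.is_comm.comm x y
  exact (StarSubalgebra.commRingTopologicalClosure _ h1).mul_comm

/-- The universal property of `C(Y)`, with respect to a point-separating family `f`: a commuting
family `a` of normal elements of a C⋆-algebra is the image of `f` as soon as each character of the
C⋆-algebra generated by `a` takes on it the values of `f` at some point of `Y`. By Gelfand duality,
sending the character to that point gives the homomorphism. -/
theorem exists_continuousMap_lift {f : ι → C(Y, ℂ)} (hf : ∀ x y, (∀ i, f i x = f i y) → x = y)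
    (a : ι → A) (hc : ∀ i j, a i * a j = a j * a i)
    (hc' : ∀ i j, a i * star (a j) = star (a j) * a i)
    (hχ : ∀ (S : StarSubalgebra ℂ A) (χ : S →⋆ₐ[ℂ] ℂ) (ha : ∀ i, a i ∈ S),
      ∃ y, ∀ i, χ ⟨a i, ha i⟩ = f i y) :
    ∃ φ : C(Y, ℂ) →⋆ₐ[ℂ] A, ∀ i, φ (f i) = a i := by
  let S := (StarAlgebra.adjoin ℂ (Set.range a)).topologicalClosure
  have hS : IsClosed (S : Set A) := StarSubalgebra.isClosed_topologicalClosure _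
  let _ : CommCStarAlgebra S :=
    { StarSubalgebra.cstarAlgebra S with
      mul_comm := closureAdjoin_mul_comm
        (by rintro _ ⟨i, rfl⟩ _ ⟨j, rfl⟩; exact hc i j)
        (by rintro _ ⟨i, rfl⟩ _ ⟨j, rfl⟩; exact hc' i j) }
  have ha : ∀ i, a i ∈ S := fun i =>
    StarSubalgebra.le_topologicalClosure _ (StarAlgebra.subset_adjoin ℂ _ ⟨i, rfl⟩)
  choose p hp using fun χ : WeakDual.characterSpace ℂ S => hχ S (χ : S →⋆ₐ[ℂ] ℂ) ha
  have hemb : Topology.IsClosedEmbedding fun y i => f i y :=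
    Continuous.isClosedEmbedding (by fun_prop) fun x y h => hf x y (congrFun h)
  have hpc : Continuous p := by
    rw [hemb.isInducing.continuous_iff]
    refine continuous_pi fun i => ?_
    have : (fun χ => f i (p χ)) = fun χ : WeakDual.characterSpace ℂ S => χ ⟨a i, ha i⟩ :=
      funext fun χ => (hp χ i).symm
    change Continuous fun χ => f i (p χ)
    rw [this]
    exact (WeakDual.eval_continuous _).comp continuous_subtype_val
  let P : C(WeakDual.characterSpace ℂ S, Y) := ⟨p, hpc⟩
  let φ : C(Y, ℂ) →⋆ₐ[ℂ] S :=
    ((gelfandStarTransform S).symm : C(WeakDual.characterSpace ℂ S, ℂ) →⋆ₐ[ℂ] S).comp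
      (ContinuousMap.compStarAlgHom' ℂ ℂ P)
  refine ⟨S.subtype.comp φ, fun i => ?_⟩
  have h1 : φ (f i) = ⟨a i, ha i⟩ := by
    refine (gelfandStarTransform S).injective ?_
    refine ((gelfandStarTransform S).apply_symm_apply _).trans ?_
    ext χ
    exact (hp χ i).symm
  exact congrArg Subtype.val h1

end Commutative

/-! ### Representations of free products and of `C(Y ∘ Y)` -/

section FreeProductLift

open FreeStar

variable {A B D : Type} [CStarAlgebra A] [CStarAlgebra B] [CStarAlgebra D]

theorem satisfies_homRel {X : Type} {j : A → X} {a : X → D} (φ : A →⋆ₐ[ℂ] D)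
    (h : ∀ x, a (j x) = φ x) : Satisfies (homRel j) a := by
  rintro r (rfl | ⟨x, y, rfl⟩ | ⟨x, y, rfl⟩ | ⟨c, x, rfl⟩ | ⟨x, rfl⟩) <;>
    simp only [map_sub, map_add, map_mul, map_one, map_smul, map_star, eval_gen, h, sub_self]

theorem exists_freeProd_lift (φ : A →⋆ₐ[ℂ] D) (ψ : B →⋆ₐ[ℂ] D) :
    ∃ θ : FreeProd A B →⋆ₐ[ℂ] D, (∀ a, θ (freeInl a) = φ a) ∧ ∀ b, θ (freeInr b) = ψ b := by
  obtain ⟨θ, hθ⟩ := exists_univ_lift (freeProdRel A B) (Sum.elim φ ψ) (by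
    rintro r (hr | hr)
    · exact satisfies_homRel (j := Sum.inl) φ (fun _ => rfl) r hr
    · exact satisfies_homRel (j := Sum.inr) ψ (fun _ => rfl) r hr)
  exact ⟨θ, fun a => hθ (Sum.inl a), fun b => hθ (Sum.inr b)⟩

variable (A B) in
/-- The copy of `A` in the free product, as a star homomorphism. -/
def freeInlHom : A →⋆ₐ[ℂ] FreeProd A B :=
  homOfRel Sum.inl _ fun r hr => satisfies_univGen (freeProdRel A B) r (Or.inl hr)

variable (A B) in
/-- The copy of `B` in the free product, as a star homomorphism. -/
def freeInrHom : B →⋆ₐ[ℂ] FreeProd A B :=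
  homOfRel Sum.inr _ fun r hr => satisfies_univGen (freeProdRel A B) r (Or.inr hr)

/-- The universal property of `C(𝕋)`: unitaries are the images of its standard generator. -/
theorem exists_circle_lift (u : D) (hu : u ∈ unitary D) :
    ∃ ψ : C(Circle, ℂ) →⋆ₐ[ℂ] D, ψ ⟨fun w => (w : ℂ), continuous_subtype_val⟩ = u := by
  have h := exists_continuousMap_lift (ι := Unit)
    (f := fun _ => (⟨fun w => (w : ℂ), continuous_subtype_val⟩ : C(Circle, ℂ)))
    (fun x y h => Subtype.ext (h ())) (fun _ => u) (fun _ _ => rfl)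
    (fun _ _ => by rw [hu.1, hu.2])
    (fun S χ hS => by
      have h1 : star (χ ⟨u, hS ()⟩) * χ ⟨u, hS ()⟩ = 1 := by
        rw [← map_star, ← map_mul, ← map_one χ]
        exact congrArg χ (Subtype.ext hu.1)
      have h2 : ‖χ ⟨u, hS ()⟩‖ = 1 := by
        have h3 := congrArg norm h1
        rw [norm_mul, norm_star, norm_one] at h3
        nlinarith [norm_nonneg (χ ⟨u, hS ()⟩)]
      exact ⟨⟨χ ⟨u, hS ()⟩, mem_sphere_zero_iff_norm.mpr h2⟩, fun _ => rfl⟩)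
  obtain ⟨ψ, hψ⟩ := h
  exact ⟨ψ, hψ ()⟩

theorem freeUnitary_mem : freeUnitary A ∈ unitary (FreeProd A C(Circle, ℂ)) := by
  have h : (⟨fun w => (w : ℂ), continuous_subtype_val⟩ : C(Circle, ℂ)) ∈ unitary C(Circle, ℂ) := by
    constructor <;> ext w
    · change (starRingEnd ℂ) (w : ℂ) * (w : ℂ) = 1
      rw [mul_comm, Complex.mul_conj]
      simp
    · change (w : ℂ) * (starRingEnd ℂ) (w : ℂ) = 1
      rw [Complex.mul_conj]
      simp
  exact Unitary.map_mem (freeInrHom A C(Circle, ℂ)) h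

/-- Diagonal matrices with entries given by star homomorphisms. -/
def diagHom {ι : Type} [Fintype ι] [DecidableEq ι] (φ : ι → A →⋆ₐ[ℂ] D) :
    A →⋆ₐ[ℂ] CStarMatrix ι ι D where
  toFun a := CStarMatrix.ofMatrix (Matrix.diagonal fun i => φ i a)
  map_one' := by
    simp only [map_one]
    exact Matrix.diagonal_one
  map_mul' a b := by
    simp only [map_mul]
    exact (Matrix.diagonal_mul_diagonal _ _).symm
  map_zero' := by
    simp only [map_zero]
    exact Matrix.diagonal_zero
  map_add' a b := by
    simp only [map_add]
    exact (Matrix.diagonal_add _ _).symm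
  commutes' c := by
    simp only [AlgHomClass.commutes]
    rfl
  map_star' a := by
    simp only [map_star]
    exact (Matrix.diagonal_conjTranspose _).symm

theorem diagHom_apply {ι : Type} [Fintype ι] [DecidableEq ι] (φ : ι → A →⋆ₐ[ℂ] D) (a : A)
    (i j : ι) : diagHom φ a i j = if i = j then φ i a else 0 := Matrix.diagonal_apply ..

/-- The self-adjoint unitary exchanging two direct summands. -/
def flipMatrix (D : Type) [CStarAlgebra D] : CStarMatrix Bool Bool D :=
  CStarMatrix.ofMatrix fun i j => if i = j then 0 else 1

theorem flipMatrix_apply (i j : Bool) : flipMatrix D i j = if i = j then 0 else 1 := rfl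

theorem star_flipMatrix : star (flipMatrix D) = flipMatrix D := by
  ext i j
  rw [CStarMatrix.star_apply, flipMatrix_apply, flipMatrix_apply]
  cases i <;> cases j <;> simp

theorem flipMatrix_mul_self : flipMatrix D * flipMatrix D = 1 := by
  ext i j
  rw [CStarMatrix.mul_apply, Fintype.sum_bool]
  simp only [flipMatrix_apply, CStarMatrix.one_apply]
  cases i <;> cases j <;> simp

/-- Two arbitrary representations of `A` define one of `C(Y ∘ Y)`, where `A = C(Y)`: the direct sum
of the two, in both orders, is conjugated by the flip, which can be taken as the unitary `z`. -/
theorem exists_circProd_lift (φ ψ : A →⋆ₐ[ℂ] D) :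
    ∃ θ : circProd A →⋆ₐ[ℂ] D, (∀ a, θ (circFst a) = φ a) ∧ ∀ a, θ (circSnd a) = ψ a := by
  obtain ⟨ω, hω⟩ := exists_circle_lift (flipMatrix D)
    ⟨by rw [star_flipMatrix, flipMatrix_mul_self], by rw [star_flipMatrix, flipMatrix_mul_self]⟩
  obtain ⟨Θ, h1, h2⟩ := exists_freeProd_lift (diagHom fun b => bif b then φ else ψ) ω
  have hz : Θ (freeUnitary A) = flipMatrix D := (h2 _).trans hω
  have h3 : ∀ a, Θ (freeConj a) = diagHom (fun b => bif b then ψ else φ) a := fun a => by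
    rw [freeConj, map_mul, map_mul, map_star, hz, h1, star_flipMatrix]
    ext i j
    simp only [CStarMatrix.mul_apply, Fintype.sum_bool, flipMatrix_apply, diagHom_apply]
    cases i <;> cases j <;> simp
  obtain ⟨θ, hθ⟩ := exists_corner Θ true (s := Set.range freeInl ∪ Set.range freeConj) (by
    rintro _ (⟨a, rfl⟩ | ⟨a, rfl⟩) k hk
    · rw [h1, diagHom_apply, diagHom_apply, if_neg hk, if_neg hk.symm]
      exact ⟨rfl, rfl⟩
    · rw [h3, diagHom_apply, diagHom_apply, if_neg hk, if_neg hk.symm]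
      exact ⟨rfl, rfl⟩)
  refine ⟨θ, fun a => ?_, fun a => ?_⟩
  · refine (hθ _).trans ?_
    change Θ (freeInl a) true true = φ a
    rw [h1, diagHom_apply]
    rfl
  · refine (hθ _).trans ?_
    change Θ (freeConj a) true true = ψ a
    rw [h3, diagHom_apply]
    rfl

instance : CStarAlgebra (circProd A) :=
  haveI : IsClosed (circProd A : Set (FreeProd A C(Circle, ℂ))) :=
    StarSubalgebra.isClosed_topologicalClosure _
  StarSubalgebra.cstarAlgebra _

variable (A) in
/-- The first copy of `A` in `C(Y ∘ Y)`, as a star homomorphism. -/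
def circFstHom : A →⋆ₐ[ℂ] circProd A :=
  (freeInlHom A C(Circle, ℂ)).codRestrict _ fun a => (circFst a).2

variable (A) in
/-- The second copy of `A` in `C(Y ∘ Y)`, as a star homomorphism. -/
def circSndHom : A →⋆ₐ[ℂ] circProd A :=
  ((Unitary.conjStarAlgAut ℂ _ ⟨freeUnitary A, freeUnitary_mem⟩ :
      FreeProd A C(Circle, ℂ) →⋆ₐ[ℂ] FreeProd A C(Circle, ℂ)).comp
    (freeInlHom A C(Circle, ℂ))).codRestrict _ fun a => (circSnd a).2

theorem circProd_hom_ext {φ ψ : circProd A →⋆ₐ[ℂ] D} (h1 : ∀ a, φ (circFst a) = ψ (circFst a))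
    (h2 : ∀ a, φ (circSnd a) = ψ (circSnd a)) : φ = ψ := by
  refine closureAdjoin_ext ?_
  rintro _ (⟨a, rfl⟩ | ⟨a, rfl⟩) _
  · exact h1 a
  · exact h2 a

end FreeProductLift

/-! ### Projections of rank one and the complex projective space -/

section RankOne

variable {N : ℕ} {A : Type*} [CStarAlgebra A]

/-- The relations between the standard coordinates `pᵢⱼ` of the complex projective space: they are
the commuting entries of a projection of rank one. The rank condition is the vanishing of the
`2 × 2` minors, which together with the trace condition gives `p² = p`. -/
structure IsRankOne {A : Type*} [Ring A] [StarRing A] (p : Fin N → Fin N → A) : Prop where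
  star_eq : ∀ i j, star (p i j) = p j i
  comm : ∀ i j k l, p i j * p k l = p k l * p i j
  swap : ∀ i j k l, p i j * p k l = p i l * p k j
  trace : ∑ i, p i i = 1

theorem projCoord_mk (i j : Fin N) (v : EuclideanSpace ℂ (Fin N)) (hv : v ≠ 0) :
    projCoord i j (Projectivization.mk ℂ v hv) = v i * star (v j) / (‖v‖ : ℂ) ^ 2 := rfl

theorem norm_sq_eq_sum (v : EuclideanSpace ℂ (Fin N)) :
    (‖v‖ : ℂ) ^ 2 = ∑ i, v i * star (v i) := by
  rw [← Complex.ofReal_pow, EuclideanSpace.norm_sq_eq, Complex.ofReal_sum]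
  refine Finset.sum_congr rfl fun i _ => ?_
  rw [Complex.ofReal_pow]
  exact (Complex.mul_conj' _).symm

theorem isRankOne_projCoord : IsRankOne (A := C(CP N, ℂ)) projCoord where
  star_eq i j := by
    ext x
    induction x using Projectivization.ind with
    | h v hv =>
      change star (projCoord i j _) = _
      rw [projCoord_mk, projCoord_mk, star_div₀, star_mul', star_star, star_pow, mul_comm]
      simp
  comm i j k l := mul_comm _ _
  swap i j k l := by
    ext x
    induction x using Projectivization.ind with
    | h v hv =>
      change projCoord i j _ * projCoord k l _ = projCoord i l _ * projCoord k j _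
      simp only [projCoord_mk]
      ring
  trace := by
    ext x
    induction x using Projectivization.ind with
    | h v hv =>
      rw [ContinuousMap.sum_apply]
      simp only [projCoord_mk]
      rw [← Finset.sum_div, ← norm_sq_eq_sum, ContinuousMap.one_apply]
      exact div_self (pow_ne_zero 2 (Complex.ofReal_ne_zero.mpr (norm_ne_zero_iff.mpr hv)))

theorem projCoord_separates (x y : CP N) (h : ∀ i j, projCoord i j x = projCoord i j y) :
    x = y := by
  induction x using Projectivization.ind with
  | h v hv =>
  induction y using Projectivization.ind with
  | h w hw =>
    obtain ⟨j, hj⟩ : ∃ j, v j ≠ 0 := by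
      by_contra! h0
      exact hv (by ext j; exact h0 j)
    have hv' : (‖v‖ : ℂ) ≠ 0 := Complex.ofReal_ne_zero.mpr (norm_ne_zero_iff.mpr hv)
    have hw' : (‖w‖ : ℂ) ≠ 0 := Complex.ofReal_ne_zero.mpr (norm_ne_zero_iff.mpr hw)
    have hs : star (v j) ≠ 0 := star_ne_zero.mpr hj
    refine (Projectivization.mk_eq_mk_iff' ℂ _ _ _ _).mpr
      ⟨(‖v‖ : ℂ) ^ 2 * star (w j) / ((‖w‖ : ℂ) ^ 2 * star (v j)), ?_⟩
    ext i
    have h1 := h i j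
    rw [projCoord_mk, projCoord_mk, div_eq_div_iff (pow_ne_zero 2 hv') (pow_ne_zero 2 hw')] at h1
    rw [PiLp.smul_apply, smul_eq_mul, div_mul_eq_mul_div,
      div_eq_iff (mul_ne_zero (pow_ne_zero 2 hw') hs)]
    linear_combination -h1

/-- A projection of rank one in `M_N(ℂ)` is given by a point of the projective space. -/
theorem exists_point {m : Fin N → Fin N → ℂ} (hm : IsRankOne m) :
    ∃ y : CP N, ∀ i j, m i j = projCoord i j y := by
  obtain ⟨k, hk⟩ : ∃ k, m k k ≠ 0 := by
    by_contra! h0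
    have := hm.trace
    simp [h0] at this
  -- the `k`-th column of the matrix spans its range
  let v : EuclideanSpace ℂ (Fin N) := WithLp.toLp 2 fun i => m i k
  have hv : v ≠ 0 := fun h => hk (congrArg (fun w : EuclideanSpace ℂ (Fin N) => w k) h)
  have h1 : ∀ i j, v i * star (v j) = m i j * m k k := fun i j => by
    change m i k * star (m j k) = _
    rw [hm.star_eq, hm.swap]
  have h2 : (‖v‖ : ℂ) ^ 2 = m k k := by
    rw [norm_sq_eq_sum]
    simp only [h1]
    rw [← Finset.sum_mul, hm.trace, one_mul]
  refine ⟨Projectivization.mk ℂ v hv, fun i j => ?_⟩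
  rw [projCoord_mk, h1, h2, mul_div_cancel_right₀ _ hk]

theorem IsRankOne.map {A B : Type*} [Ring A] [StarRing A] [Algebra ℂ A] [Ring B] [StarRing B]
    [Algebra ℂ B] {p : Fin N → Fin N → A} (hp : IsRankOne p)
    (φ : A →⋆ₐ[ℂ] B) : IsRankOne fun i j => φ (p i j) where
  star_eq i j := by rw [← map_star, hp.star_eq]
  comm i j k l := by rw [← map_mul, hp.comm, map_mul]
  swap i j k l := by rw [← map_mul, hp.swap, map_mul]
  trace := by rw [← map_sum, hp.trace, map_one]

theorem IsRankOne.of_coe {S : StarSubalgebra ℂ A} {p : Fin N → Fin N → S}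
    (hp : IsRankOne fun i j => (p i j : A)) : IsRankOne p where
  star_eq i j := Subtype.ext (hp.star_eq i j)
  comm i j k l := Subtype.ext (hp.comm i j k l)
  swap i j k l := Subtype.ext (hp.swap i j k l)
  trace := Subtype.ext (by
    rw [AddSubmonoidClass.coe_finsetSum]
    exact hp.trace)

theorem IsRankOne.apply_character {p : Fin N → Fin N → A} (hp : IsRankOne p)
    {S : StarSubalgebra ℂ A} (χ : S →⋆ₐ[ℂ] ℂ) (hS : ∀ i j, p i j ∈ S) :
    IsRankOne fun i j => χ ⟨p i j, hS i j⟩ :=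
  IsRankOne.map (p := fun i j => (⟨p i j, hS i j⟩ : S)) (IsRankOne.of_coe hp) χ

/-- The universal property of `C(CP N)`: it is generated by the commuting entries of a projection of
rank one. -/
theorem IsRankOne.exists_lift {p : Fin N → Fin N → A} (hp : IsRankOne p) :
    ∃ φ : C(CP N, ℂ) →⋆ₐ[ℂ] A, ∀ i j, φ (projCoord i j) = p i j := by
  obtain ⟨φ, hφ⟩ := exists_continuousMap_lift (ι := Fin N × Fin N)
    (f := fun i => (projCoord i.1 i.2 : C(CP N, ℂ)))
    (fun x y h => projCoord_separates x y fun i j => h (i, j)) (fun i => p i.1 i.2)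
    (fun _ _ => hp.comm _ _ _ _) (fun _ _ => by rw [hp.star_eq, hp.comm])
    (fun S χ hS => by
      obtain ⟨y, hy⟩ := exists_point (hp.apply_character χ fun i j => hS (i, j))
      exact ⟨y, fun i => hy i.1 i.2⟩)
  exact ⟨φ, fun i j => hφ (i, j)⟩

theorem projSpace_hom_ext {φ ψ : C(CP N, ℂ) →⋆ₐ[ℂ] A}
    (h : ∀ i j, φ (projCoord i j) = ψ (projCoord i j)) : φ = ψ :=
  continuousMap_hom_ext (f := fun i : Fin N × Fin N => (projCoord i.1 i.2 : C(CP N, ℂ)))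
    (fun x y h => projCoord_separates x y fun i j => h (i, j)) fun i => h i.1 i.2

theorem circProd_projSpace_hom_ext {D : Type} [CStarAlgebra D]
    {φ ψ : circProd C(CP N, ℂ) →⋆ₐ[ℂ] D}
    (h1 : ∀ i j, φ (circFst (projCoord i j)) = ψ (circFst (projCoord i j)))
    (h2 : ∀ i j, φ (circSnd (projCoord i j)) = ψ (circSnd (projCoord i j))) : φ = ψ := by
  refine circProd_hom_ext (fun f => ?_) fun f => ?_
  · exact DFunLike.congr_fun
      (projSpace_hom_ext (φ := φ.comp (circFstHom _)) (ψ := ψ.comp (circFstHom _)) h1) f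
  · exact DFunLike.congr_fun
      (projSpace_hom_ext (φ := φ.comp (circSndHom _)) (ψ := ψ.comp (circSndHom _)) h2) f

/-- The coordinates on the product of two projective spaces. -/
def prodCoord : (Fin N × Fin N) ⊕ (Fin N × Fin N) → C(CP N × CP N, ℂ) :=
  Sum.elim (fun i => tensorLeft (projCoord i.1 i.2)) (fun i => tensorRight (projCoord i.1 i.2))

theorem prodCoord_separates (x y : CP N × CP N) (h : ∀ i, prodCoord i x = prodCoord i y) :
    x = y :=
  Prod.ext (projCoord_separates _ _ fun i j => h (Sum.inl (i, j)))
    (projCoord_separates _ _ fun i j => h (Sum.inr (i, j)))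

theorem prod_hom_ext {φ ψ : C(CP N × CP N, ℂ) →⋆ₐ[ℂ] A}
    (h1 : ∀ i j, φ (tensorLeft (projCoord i j)) = ψ (tensorLeft (projCoord i j)))
    (h2 : ∀ i j, φ (tensorRight (projCoord i j)) = ψ (tensorRight (projCoord i j))) : φ = ψ := by
  refine continuousMap_hom_ext prodCoord_separates ?_
  rintro (i | i)
  · exact h1 i.1 i.2
  · exact h2 i.1 i.2

/-- The universal property of `C(CP N × CP N)`: it is generated by the entries of two commuting
projections of rank one. -/
theorem IsRankOne.exists_prod_lift {p q : Fin N → Fin N → A} (hp : IsRankOne p) (hq : IsRankOne q)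
    (hpq : ∀ i j k l, p i j * q k l = q k l * p i j) :
    ∃ φ : C(CP N × CP N, ℂ) →⋆ₐ[ℂ] A, (∀ i j, φ (tensorLeft (projCoord i j)) = p i j) ∧
      ∀ i j, φ (tensorRight (projCoord i j)) = q i j := by
  obtain ⟨φ, hφ⟩ := exists_continuousMap_lift prodCoord_separates
    (Sum.elim (fun i => p i.1 i.2) (fun i => q i.1 i.2))
    (by
      rintro (i | i) (j | j)
      · exact hp.comm _ _ _ _
      · exact hpq _ _ _ _
      · exact (hpq _ _ _ _).symm
      · exact hq.comm _ _ _ _)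
    (by
      rintro (i | i) (j | j) <;> simp only [Sum.elim_inl, Sum.elim_inr, hp.star_eq, hq.star_eq]
      · exact hp.comm _ _ _ _
      · exact hpq _ _ _ _
      · exact (hpq _ _ _ _).symm
      · exact hq.comm _ _ _ _)
    (fun S χ hS => by
      obtain ⟨y, hy⟩ := exists_point (hp.apply_character χ fun i j => hS (Sum.inl (i, j)))
      obtain ⟨z, hz⟩ := exists_point (hq.apply_character χ fun i j => hS (Sum.inr (i, j)))
      refine ⟨(y, z), ?_⟩
      rintro (i | i)
      · exact hy i.1 i.2
      · exact hz i.1 i.2)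
  exact ⟨φ, fun i j => hφ (Sum.inl (i, j)), fun i j => hφ (Sum.inr (i, j))⟩

end RankOne

/-! ### The relations of the spheres -/

section SphereRelations

open FreeStar

variable {N : ℕ}

/-- The relations of the coordinates of the sphere `S_{ℂ,×}`, in an arbitrary star ring. -/
structure IsTimesSphere {A : Type*} [Ring A] [StarRing A] (x : Fin N → A) : Prop where
  sum_mul_star : ∑ i, x i * star (x i) = 1
  sum_star_mul : ∑ i, star (x i) * x i = 1
  swap : ∀ i j k, x i * star (x j) * x k = x k * star (x j) * x i

theorem satisfies_sphere_iff {A : Type} [CStarAlgebra A] {x : Fin N → A}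
    {T : Set (FreeStar (Fin N))} :
    Satisfies (freeSphereRel N ∪ T) x ↔
      (∑ i, x i * star (x i) = 1 ∧ ∑ i, star (x i) * x i = 1) ∧ Satisfies T x := by
  have h1 : eval x (∑ i, gen i * star (gen i) - 1) = ∑ i, x i * star (x i) - 1 := by
    simp only [map_sub, map_sum, map_mul, map_star, eval_gen, map_one]
  have h2 : eval x (∑ i, star (gen i) * gen i - 1) = ∑ i, star (x i) * x i - 1 := by
    simp only [map_sub, map_sum, map_mul, map_star, eval_gen, map_one]
  rw [← sub_eq_zero, ← h1, ← sub_eq_zero (a := ∑ i, star (x i) * x i), ← h2]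
  constructor
  · exact fun h => ⟨⟨h _ (Or.inl (Or.inl rfl)), h _ (Or.inl (Or.inr rfl))⟩,
      fun r hr => h r (Or.inr hr)⟩
  · rintro ⟨⟨h1, h2⟩, h⟩ r ((rfl | rfl) | hr)
    · exact h1
    · exact h2
    · exact h r hr

theorem eval_letter {A : Type} [CStarAlgebra A] (x : Fin N → A) (y : Fin N ⊕ Fin N) :
    eval x (letter y) = Sum.elim x (fun i => star (x i)) y := by
  cases y with
  | inl i => exact eval_gen x i
  | inr i =>
    have h : letter (Sum.inr i) = star (gen i) := (star_letter (Sum.inl i)).symm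
    rw [h, map_star, eval_gen]
    rfl

theorem satisfies_times_iff {A : Type} [CStarAlgebra A] {x : Fin N → A} :
    Satisfies (freeSphereRel N ∪ relTimes N) x ↔ IsTimesSphere x := by
  rw [satisfies_sphere_iff]
  constructor
  · rintro ⟨⟨h1, h2⟩, h⟩
    refine ⟨h1, h2, fun i j k => ?_⟩
    have := h _ ⟨i, j, k, rfl⟩
    rwa [map_sub, map_mul, map_mul, map_mul, map_mul, map_star, eval_gen, eval_gen, eval_gen,
      sub_eq_zero] at this
  · rintro ⟨h1, h2, h⟩
    refine ⟨⟨h1, h2⟩, ?_⟩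
    rintro _ ⟨i, j, k, rfl⟩
    rw [map_sub, map_mul, map_mul, map_mul, map_mul, map_star, eval_gen, eval_gen, eval_gen, h,
      sub_self]

theorem satisfies_starStar_iff {A : Type} [CStarAlgebra A] {x : Fin N → A} :
    Satisfies (relStarStar N) x ↔ ∀ a b c : Fin N ⊕ Fin N,
      eval x (letter a) * eval x (letter b) * eval x (letter c) =
        eval x (letter c) * eval x (letter b) * eval x (letter a) := by
  constructor
  · intro h a b c
    have := h _ ⟨a, b, c, rfl⟩
    rwa [map_sub, map_mul, map_mul, map_mul, map_mul, sub_eq_zero] at this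
  · rintro h _ ⟨a, b, c, rfl⟩
    rw [map_sub, map_mul, map_mul, map_mul, map_mul, h, sub_self]

/-- When `abc = cba` on the letters, all the words of length two commute. -/
theorem Satisfies.star_of_starStar {A : Type} [CStarAlgebra A] {x : Fin N → A}
    (h : Satisfies (relStarStar N) x) : Satisfies (relStar N) x := by
  rw [satisfies_starStar_iff] at h
  have key : ∀ a b c d : Fin N ⊕ Fin N,
      eval x (letter a * letter b) * eval x (letter c * letter d) =
        eval x (letter c * letter d) * eval x (letter a * letter b) := fun a b c d => by
    simp only [map_mul]
    rw [← mul_assoc, h a b c, mul_assoc, mul_assoc, ← mul_assoc (eval x (letter b)), h b a d]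
    simp only [mul_assoc]
  have hw : ∀ f ∈ projWords N, ∃ a b : Fin N ⊕ Fin N, f = letter a * letter b := by
    rintro f (⟨i, j, rfl⟩ | ⟨i, j, rfl⟩)
    · exact ⟨Sum.inl i, Sum.inr j, congrArg _ (star_letter (Sum.inl j))⟩
    · exact ⟨Sum.inr i, Sum.inl j, congrArg (· * gen j) (star_letter (Sum.inl i))⟩
  rintro _ ⟨f, hf, g, hg, rfl⟩
  obtain ⟨a, b, rfl⟩ := hw f hf
  obtain ⟨c, d, rfl⟩ := hw g hg
  rw [map_sub, map_mul, map_mul _ (letter c * letter d), key, sub_self]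

/-- When the elements `ab*` and `a*b` all commute, inserting `1 = ∑ xₘ* xₘ` and then removing
`∑ xₘ xₘ* = 1` gives
`ab*c = ∑ (ab*)(cxₘ*)xₘ = ∑ c(xₘ*a)(b*xₘ) = ∑ cb*xₘxₘ*a = cb*a`. -/
theorem isTimesSphere_of_star {A : Type} [CStarAlgebra A] {x : Fin N → A}
    (h : Satisfies (freeSphereRel N ∪ relStar N) x) : IsTimesSphere x := by
  obtain ⟨⟨h1, h2⟩, h⟩ := satisfies_sphere_iff.mp h
  have hc : ∀ f ∈ projWords N, ∀ g ∈ projWords N, eval x f * eval x g = eval x g * eval x f :=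
    fun f hf g hg => by
      have := h _ ⟨f, hf, g, hg, rfl⟩
      rwa [map_sub, map_mul, map_mul, sub_eq_zero] at this
  have hl : ∀ i j, eval x (gen i * star (gen j)) = x i * star (x j) := fun i j => by
    rw [map_mul, map_star, eval_gen, eval_gen]
  have hr : ∀ i j, eval x (star (gen i) * gen j) = star (x i) * x j := fun i j => by
    rw [map_mul, map_star, eval_gen, eval_gen]
  refine ⟨h1, h2, fun i j k => ?_⟩
  have hm : ∀ m, x i * star (x j) * x k * (star (x m) * x m) =
      x k * star (x j) * (x m * star (x m)) * x i := fun m => by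
    have e1 := hc _ (Or.inl ⟨i, j, rfl⟩) _ (Or.inl ⟨k, m, rfl⟩)
    have e2 := hc _ (Or.inr ⟨m, i, rfl⟩) _ (Or.inr ⟨j, m, rfl⟩)
    rw [hl, hl] at e1
    rw [hr, hr] at e2
    calc x i * star (x j) * x k * (star (x m) * x m)
        = x i * star (x j) * (x k * star (x m)) * x m := by simp only [mul_assoc]
      _ = x k * (star (x m) * x i * (star (x j) * x m)) := by rw [e1]; simp only [mul_assoc]
      _ = x k * star (x j) * (x m * star (x m)) * x i := by rw [e2]; simp only [mul_assoc]
  have e := Finset.sum_congr (rfl : Finset.univ = Finset.univ) fun m _ => hm m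
  rwa [← Finset.mul_sum, h2, mul_one, ← Finset.sum_mul, ← Finset.mul_sum, h1, mul_one] at e

theorem IsTimesSphere.swap_star {A : Type*} [Ring A] [StarRing A] {x : Fin N → A}
    (h : IsTimesSphere x) (i j k : Fin N) :
    star (x i) * x j * star (x k) = star (x k) * x j * star (x i) := by
  have := congrArg star (h.swap k j i)
  simpa only [star_mul, star_star, mul_assoc] using this

theorem IsTimesSphere.isRankOne_left {A : Type*} [CStarAlgebra A] {x : Fin N → A}
    (h : IsTimesSphere x) : IsRankOne fun i j => x i * star (x j) where
  star_eq i j := by rw [star_mul, star_star]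
  comm i j k l := by
    rw [← mul_assoc, h.swap, mul_assoc, mul_assoc, ← mul_assoc (star (x j)), h.swap_star]
    simp only [mul_assoc]
  swap i j k l := by
    rw [mul_assoc, ← mul_assoc (star (x j)), h.swap_star]
    simp only [mul_assoc]
  trace := h.sum_mul_star

theorem IsTimesSphere.isRankOne_right {A : Type*} [CStarAlgebra A] {x : Fin N → A}
    (h : IsTimesSphere x) : IsRankOne fun i j => star (x j) * x i where
  star_eq i j := by rw [star_mul, star_star]
  comm i j k l := by
    rw [← mul_assoc, h.swap_star, mul_assoc, mul_assoc, ← mul_assoc (x i), h.swap]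
    simp only [mul_assoc]
  swap i j k l := by
    rw [← mul_assoc, h.swap_star]
    simp only [mul_assoc]
  trace := h.sum_star_mul

/-- The relations are preserved by multiplication on the right by a unitary. -/
theorem IsTimesSphere.mul_unitary {A : Type*} [Ring A] [StarRing A] {x : Fin N → A}
    (h : IsTimesSphere x) {u : A} (hu : u ∈ unitary A) : IsTimesSphere fun i => x i * star u := by
  have h1 : ∀ i j, x i * star u * star (x j * star u) = x i * star (x j) := fun i j => by
    rw [star_mul, star_star, mul_assoc, ← mul_assoc (star u), hu.1, one_mul]
  refine ⟨?_, ?_, fun i j k => ?_⟩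
  · simp only [h1, h.sum_mul_star]
  · have h2 : ∀ i, star (x i * star u) * (x i * star u) = u * (star (x i) * x i) * star u :=
      fun i => by rw [star_mul, star_star]; simp only [mul_assoc]
    simp only [h2]
    rw [← Finset.sum_mul, ← Finset.mul_sum, h.sum_star_mul, mul_one, hu.2]
  · rw [h1, h1, ← mul_assoc, ← mul_assoc, h.swap]

end SphereRelations

/-! ### Representations of `C(S_{ℂ,**})` by antidiagonal matrices -/

section Antidiagonal

open FreeStar

variable {N : ℕ}

/-- The antidiagonal `2 × 2` matrix with entries `a`, in the row of `true`, and `b`, in the row of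
`false`. -/
def antidiag (a b : ℂ) : CStarMatrix Bool Bool ℂ :=
  CStarMatrix.ofMatrix fun i j => if i = j then 0 else bif i then a else b

theorem antidiag_apply (a b : ℂ) (i j : Bool) :
    antidiag a b i j = if i = j then 0 else bif i then a else b := rfl

theorem star_antidiag (a b : ℂ) : star (antidiag a b) = antidiag (star b) (star a) := by
  ext i j
  rw [CStarMatrix.star_apply, antidiag_apply, antidiag_apply]
  cases i <;> cases j <;> simp

theorem antidiag_mul (a b c d : ℂ) (i j : Bool) :
    (antidiag a b * antidiag c d) i j = if i = j then (bif i then a * d else b * c) else 0 := by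
  simp only [CStarMatrix.mul_apply, Fintype.sum_bool, antidiag_apply]
  cases i <;> cases j <;> simp

theorem antidiag_mul_mul (a b c d e f : ℂ) :
    antidiag a b * antidiag c d * antidiag e f = antidiag (a * d * e) (b * c * f) := by
  ext i j
  rw [CStarMatrix.mul_apply, Fintype.sum_bool]
  simp only [antidiag_mul, antidiag_apply]
  cases i <;> cases j <;> simp

/-- Two unit vectors `v` and `w` define a point of `S_{ℂ,**}`: in a product of three antidiagonal
matrices the outer factors can be exchanged. -/
theorem satisfies_antidiag {v w : Fin N → ℂ} (hv : ∑ i, v i * star (v i) = 1)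
    (hw : ∑ i, w i * star (w i) = 1) :
    Satisfies (freeSphereRel N ∪ relStarStar N) fun i => antidiag (v i) (w i) := by
  have hs : ∀ (f : Fin N → CStarMatrix Bool Bool ℂ) (i j : Bool),
      (∑ k, f k) i j = ∑ k, f k i j := fun f i j => Matrix.sum_apply i j _ _
  refine satisfies_sphere_iff.mpr ⟨⟨?_, ?_⟩, ?_⟩
  · ext i j
    simp only [hs, star_antidiag, antidiag_mul, CStarMatrix.one_apply]
    cases i <;> cases j <;> first | (simp; done) | simpa using hv | simpa using hw
  · ext i j
    simp only [hs, star_antidiag, antidiag_mul, CStarMatrix.one_apply]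
    simp only [mul_comm (v _), mul_comm (w _)] at hv hw
    cases i <;> cases j <;> first | (simp; done) | simpa using hv | simpa using hw
  · rw [satisfies_starStar_iff]
    have hl : ∀ y, ∃ a b, eval (fun i => antidiag (v i) (w i)) (letter y) = antidiag a b := by
      intro y
      rw [eval_letter]
      cases y with
      | inl i => exact ⟨_, _, rfl⟩
      | inr i => exact ⟨_, _, star_antidiag _ _⟩
    intro a b c
    obtain ⟨a1, a2, ha⟩ := hl a
    obtain ⟨b1, b2, hb⟩ := hl b
    obtain ⟨c1, c2, hc⟩ := hl c
    rw [ha, hb, hc, antidiag_mul_mul, antidiag_mul_mul, mul_right_comm, mul_comm a1,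
      mul_right_comm a2, mul_comm a2]
    congr 1 <;> ring

theorem exists_unit_vector (y : CP N) :
    ∃ v : Fin N → ℂ, ∀ i j, v i * star (v j) = projCoord i j y := by
  induction y using Projectivization.ind with
  | h v hv =>
    refine ⟨fun i => (‖v‖ : ℂ)⁻¹ * v i, fun i j => ?_⟩
    have hs : star (‖v‖ : ℂ) = ‖v‖ := Complex.conj_ofReal _
    change (‖v‖ : ℂ)⁻¹ * v i * star ((‖v‖ : ℂ)⁻¹ * v j) = _
    rw [projCoord_mk, _root_.star_mul', star_inv₀, hs, div_eq_mul_inv]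
    ring

end Antidiagonal

/-! ### Line bundles representing `C(S_{ℂ,×})` -/

section LineBundle

variable {N : ℕ}

/-- `p` for `false`, and its transpose for `true`. -/
def transposeIf {A : Type} (p : Fin N → Fin N → A) (b : Bool) (i j : Fin N) : A :=
  bif b then p j i else p i j

theorem transposeIf_not {A : Type} {p : Fin N → Fin N → A} (b : Bool) (i j : Fin N) :
    transposeIf p (!b) i j = transposeIf p b j i := by
  cases b <;> rfl

variable {A : Type} [CStarAlgebra A] {p : Fin N → Fin N → A}

theorem IsRankOne.transpose (hp : IsRankOne p) : IsRankOne fun i j => p j i where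
  star_eq i j := hp.star_eq j i
  comm i j k l := hp.comm _ _ _ _
  swap i j k l := by rw [hp.swap, hp.comm]
  trace := hp.trace

theorem IsRankOne.sum_mul (hp : IsRankOne p) (i j : Fin N) : ∑ k, p i k * p k j = p i j := by
  simp only [fun k => hp.swap i k k j]
  rw [← Finset.mul_sum, hp.trace, mul_one]

theorem IsRankOne.sum_mul' (hp : IsRankOne p) (i j : Fin N) : ∑ k, p k j * p i k = p i j := by
  simp only [fun k => hp.comm k j i k]
  exact hp.sum_mul i j

/-- The summands of the bundle on which the coordinates of `S_{ℂ,×}` act: two trivial line bundles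
`0` (`false`) and `0'` (`true`), and the trivial bundles of rank `N` containing the two line bundles
`L⁻¹` (`false`) and `L` (`true`) which are the ranges of `p` and of its transpose. Writing
`pᵢⱼ = zᵢz̄ⱼ`, the function `zᵢ` is a section of `L`, and the `i`-th coordinate is multiplication by
`zᵢ` on `0 → L` and on `L⁻¹ → 0`, and by `z̄ᵢ` on `0' → L⁻¹` and on `L → 0'`. -/
abbrev BundleIndex (N : ℕ) : Type := Bool ⊕ (Bool × Fin N)

theorem IsRankOne.on_transposeIf (hp : IsRankOne p) (b : Bool) : IsRankOne (transposeIf p b) := by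
  cases b
  · exact hp
  · exact hp.transpose

open Matrix

/-- The `i`-th coordinate, from `L⁻¹` and `L` to `0` and `0'`: the rows `(pᵢₖ)ₖ` and `(pₖᵢ)ₖ`. -/
def rowBlock (p : Fin N → Fin N → A) (i : Fin N) : Matrix Bool (Bool × Fin N) A :=
  fun a k => if a = k.1 then transposeIf p a i k.2 else 0

/-- The `i`-th coordinate, from `0` and `0'` to `L` and `L⁻¹`: the columns `(pᵢₖ)ₖ` and `(pₖᵢ)ₖ`. -/
def colBlock (p : Fin N → Fin N → A) (i : Fin N) : Matrix (Bool × Fin N) Bool A :=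
  fun k a => if a = !k.1 then transposeIf p a i k.2 else 0

/-- The projection onto `L⁻¹ ⊕ L`, inside the trivial bundles of rank `N`. -/
def lineProj (p : Fin N → Fin N → A) : Matrix (Bool × Fin N) (Bool × Fin N) A :=
  fun k l => if k.1 = l.1 then transposeIf p k.1 k.2 l.2 else 0

/-- The diagonal matrix with entries `pᵢⱼ` and `pⱼᵢ`. -/
def diagBlock (p : Fin N → Fin N → A) (i j : Fin N) : Matrix Bool Bool A :=
  diagonal fun a => transposeIf p a i j

theorem rowBlock_mul_star (hp : IsRankOne p) (i j : Fin N) :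
    rowBlock p i * (rowBlock p j)ᴴ = diagBlock p i j := by
  ext a b
  simp only [mul_apply, conjTranspose_apply, Fintype.sum_prod_type, Fintype.sum_bool, rowBlock,
    diagBlock, diagonal_apply]
  have h := fun a => (hp.on_transposeIf a).sum_mul i j
  cases a <;> cases b <;> simp [(hp.on_transposeIf _).star_eq, h]

theorem star_mul_colBlock (hp : IsRankOne p) (i j : Fin N) :
    (colBlock p j)ᴴ * colBlock p i = diagBlock p i j := by
  ext a b
  simp only [mul_apply, conjTranspose_apply, Fintype.sum_prod_type, Fintype.sum_bool, colBlock,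
    diagBlock, diagonal_apply]
  have h := fun a => (hp.on_transposeIf a).sum_mul' i j
  cases a <;> cases b <;> simp [(hp.on_transposeIf _).star_eq, h]

theorem sum_star_mul_rowBlock (hp : IsRankOne p) :
    ∑ i, (rowBlock p i)ᴴ * rowBlock p i = lineProj p := by
  ext ⟨a, k⟩ ⟨b, l⟩
  simp only [Matrix.sum_apply, mul_apply, conjTranspose_apply, Fintype.sum_bool, rowBlock, lineProj]
  have h := fun a => (hp.on_transposeIf a).sum_mul k l
  cases a <;> cases b <;> simp [(hp.on_transposeIf _).star_eq, h]

theorem sum_colBlock_mul_star (hp : IsRankOne p) :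
    ∑ i, colBlock p i * (colBlock p i)ᴴ = lineProj p := by
  ext ⟨a, k⟩ ⟨b, l⟩
  simp only [Matrix.sum_apply, mul_apply, conjTranspose_apply, Fintype.sum_bool, colBlock, lineProj]
  have h := fun a => (hp.on_transposeIf a).sum_mul' l k
  have h1 := transposeIf_not (p := p) true
  rw [Bool.not_true] at h1
  cases a <;> cases b <;> simp [(hp.on_transposeIf _).star_eq, h, h1]
  exact (hp.on_transposeIf true).sum_mul k l

theorem rowBlock_mul_lineProj (hp : IsRankOne p) (i : Fin N) :
    rowBlock p i * lineProj p = rowBlock p i := by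
  ext a ⟨b, l⟩
  simp only [mul_apply, Fintype.sum_prod_type, Fintype.sum_bool, rowBlock, lineProj]
  have h := fun a => (hp.on_transposeIf a).sum_mul i l
  cases a <;> cases b <;> simp [h]

theorem star_lineProj (hp : IsRankOne p) : (lineProj p)ᴴ = lineProj p := by
  ext ⟨a, k⟩ ⟨b, l⟩
  simp only [conjTranspose_apply, lineProj]
  cases a <;> cases b <;> simp [(hp.on_transposeIf _).star_eq]

theorem lineProj_mul_self (hp : IsRankOne p) : lineProj p * lineProj p = lineProj p := by
  nth_rewrite 1 [← sum_star_mul_rowBlock hp]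
  rw [Finset.sum_mul]
  simp only [Matrix.mul_assoc, rowBlock_mul_lineProj hp]
  exact sum_star_mul_rowBlock hp

theorem lineProj_mul_colBlock (hp : IsRankOne p) (i : Fin N) :
    lineProj p * colBlock p i = colBlock p i := by
  ext ⟨b, l⟩ a
  simp only [mul_apply, Fintype.sum_prod_type, Fintype.sum_bool, colBlock, lineProj]
  have h := fun a => (hp.on_transposeIf a).sum_mul' i l
  have h1 := transposeIf_not (p := p) true
  rw [Bool.not_true] at h1
  cases a <;> cases b <;> simp [h1]
  · exact (hp.on_transposeIf true).sum_mul l i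
  · exact (hp.on_transposeIf true).sum_mul' i l

theorem rowBlock_mul_compl (hp : IsRankOne p) (i : Fin N) :
    rowBlock p i * (1 - lineProj p) = 0 := by
  rw [Matrix.mul_sub, Matrix.mul_one, rowBlock_mul_lineProj hp, sub_self]

theorem compl_mul_colBlock (hp : IsRankOne p) (i : Fin N) :
    (1 - lineProj p) * colBlock p i = 0 := by
  rw [Matrix.sub_mul, Matrix.one_mul, lineProj_mul_colBlock hp, sub_self]

theorem star_compl (hp : IsRankOne p) : (1 - lineProj p)ᴴ = 1 - lineProj p := by
  rw [conjTranspose_sub, conjTranspose_one, star_lineProj hp]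

theorem compl_mul_compl (hp : IsRankOne p) :
    (1 - lineProj p) * (1 - lineProj p) = 1 - lineProj p := by
  rw [Matrix.mul_sub, Matrix.mul_one, Matrix.sub_mul, Matrix.one_mul, lineProj_mul_self hp,
    sub_self, sub_zero]

theorem compl_mul_star_rowBlock (hp : IsRankOne p) (i : Fin N) :
    (1 - lineProj p) * (rowBlock p i)ᴴ = 0 := by
  rw [← star_compl hp, ← conjTranspose_mul, rowBlock_mul_compl hp, conjTranspose_zero]

theorem star_colBlock_mul_compl (hp : IsRankOne p) (i : Fin N) :
    (colBlock p i)ᴴ * (1 - lineProj p) = 0 := by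
  rw [← star_compl hp, ← conjTranspose_mul, compl_mul_colBlock hp, conjTranspose_zero]

theorem diagBlock_mul_rowBlock (hp : IsRankOne p) (i j k : Fin N) :
    diagBlock p i j * rowBlock p k = diagBlock p k j * rowBlock p i := by
  ext a ⟨b, l⟩
  simp only [diagBlock, diagonal_mul, rowBlock, mul_ite, mul_zero]
  rw [(hp.on_transposeIf a).swap, (hp.on_transposeIf a).comm]

theorem colBlock_mul_diagBlock (hp : IsRankOne p) (i j k : Fin N) :
    colBlock p i * diagBlock p k j = colBlock p k * diagBlock p i j := by
  ext ⟨b, l⟩ a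
  simp only [diagBlock, mul_diagonal, colBlock, ite_mul, zero_mul]
  rw [(hp.on_transposeIf a).swap, (hp.on_transposeIf a).comm]

/-- The `i`-th coordinate on the complement of `L⁻¹ ⊕ L`, where the coordinates are those of the
`i₀`-th standard basis vector. -/
def complBlock (p : Fin N → Fin N → A) (i₀ i : Fin N) : Matrix (Bool × Fin N) (Bool × Fin N) A :=
  if i = i₀ then 1 - lineProj p else 0

/-- The action of the `i`-th coordinate of `S_{ℂ,×}` on the bundles of `BundleIndex`. -/
def bundleCoord (p : Fin N → Fin N → A) (i₀ i : Fin N) :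
    Matrix (BundleIndex N) (BundleIndex N) A :=
  (fromBlocks 0 (rowBlock p i) (colBlock p i) (complBlock p i₀ i))

theorem bundleCoord_mul_star (hp : IsRankOne p) (i₀ i j : Fin N) :
    bundleCoord p i₀ i * star (bundleCoord p i₀ j) =
      (fromBlocks (diagBlock p i j) 0 0
        (colBlock p i * (colBlock p j)ᴴ + complBlock p i₀ i * (complBlock p i₀ j)ᴴ)) := by
  rw [star_eq_conjTranspose, bundleCoord, bundleCoord, fromBlocks_conjTranspose,
    fromBlocks_multiply, rowBlock_mul_star hp]
  have h1 : rowBlock p i * (complBlock p i₀ j)ᴴ = 0 := by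
    rw [complBlock]
    split_ifs
    · rw [star_compl hp, rowBlock_mul_compl hp]
    · rw [conjTranspose_zero, Matrix.mul_zero]
  have h2 : complBlock p i₀ i * (rowBlock p j)ᴴ = 0 := by
    rw [complBlock]
    split_ifs
    · rw [compl_mul_star_rowBlock hp]
    · rw [Matrix.zero_mul]
  simp only [conjTranspose_zero, Matrix.mul_zero, Matrix.zero_mul, zero_add, add_zero, h1, h2]

theorem star_mul_bundleCoord (hp : IsRankOne p) (i₀ i j : Fin N) :
    star (bundleCoord p i₀ j) * bundleCoord p i₀ i =
      (fromBlocks (diagBlock p i j) 0 0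
        ((rowBlock p j)ᴴ * rowBlock p i + (complBlock p i₀ j)ᴴ * complBlock p i₀ i)) := by
  rw [star_eq_conjTranspose, bundleCoord, bundleCoord, fromBlocks_conjTranspose,
    fromBlocks_multiply, star_mul_colBlock hp]
  have h1 : (colBlock p j)ᴴ * complBlock p i₀ i = 0 := by
    rw [complBlock]
    split_ifs
    · rw [star_colBlock_mul_compl hp]
    · rw [Matrix.mul_zero]
  have h2 : (complBlock p i₀ j)ᴴ * colBlock p i = 0 := by
    rw [complBlock]
    split_ifs
    · rw [star_compl hp, compl_mul_colBlock hp]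
    · rw [conjTranspose_zero, Matrix.zero_mul]
  simp only [conjTranspose_zero, Matrix.mul_zero, Matrix.zero_mul, zero_add, add_zero, h1, h2]

theorem sum_diagBlock (hp : IsRankOne p) : ∑ i, diagBlock p i i = 1 := by
  ext a b
  rw [Matrix.sum_apply]
  simp only [diagBlock, diagonal_apply, one_apply]
  split_ifs
  · exact (hp.on_transposeIf a).trace
  · exact Finset.sum_const_zero

theorem sum_fromBlocks {ι m n : Type} [Fintype ι] (f : ι → Matrix m m A) (g : ι → Matrix n n A) :
    ∑ i, fromBlocks (f i) 0 0 (g i) = fromBlocks (∑ i, f i) 0 0 (∑ i, g i) := by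
  ext (a | a) (b | b) <;> simp [Matrix.sum_apply]

theorem isTimesSphere_bundleCoord (hp : IsRankOne p) (i₀ : Fin N) :
    IsTimesSphere (bundleCoord p i₀) where
  sum_mul_star := by
    simp only [bundleCoord_mul_star hp]
    refine (sum_fromBlocks _ _).trans ?_
    rw [sum_diagBlock hp, Finset.sum_add_distrib, sum_colBlock_mul_star hp]
    simp only [complBlock, ite_mul, Matrix.zero_mul, Finset.sum_ite_eq', Finset.mem_univ, if_true]
    rw [star_compl hp, compl_mul_compl hp, add_sub_cancel, fromBlocks_one]
  sum_star_mul := by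
    simp only [star_mul_bundleCoord hp]
    refine (sum_fromBlocks _ _).trans ?_
    rw [sum_diagBlock hp, Finset.sum_add_distrib, sum_star_mul_rowBlock hp]
    simp only [complBlock, mul_ite, Matrix.mul_zero, Finset.sum_ite_eq', Finset.mem_univ, if_true]
    rw [star_compl hp, compl_mul_compl hp, add_sub_cancel, fromBlocks_one]
  swap i j k := by
    have key : ∀ i j k, bundleCoord p i₀ i * star (bundleCoord p i₀ j) * bundleCoord p i₀ k =
        (fromBlocks 0 (diagBlock p i j * rowBlock p k)
          (colBlock p i * diagBlock p k j)
          (complBlock p i₀ i * (complBlock p i₀ j)ᴴ * complBlock p i₀ k)) := fun i j k => by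
      rw [bundleCoord_mul_star hp, bundleCoord]
      have h : (colBlock p j)ᴴ * complBlock p i₀ k = 0 := by
        rw [complBlock]
        split_ifs
        · rw [star_colBlock_mul_compl hp]
        · rw [Matrix.mul_zero]
      have h' : (complBlock p i₀ j)ᴴ * colBlock p k = 0 := by
        rw [complBlock]
        split_ifs
        · rw [star_compl hp, compl_mul_colBlock hp]
        · rw [conjTranspose_zero, Matrix.zero_mul]
      rw [fromBlocks_multiply]
      simp only [Matrix.add_mul, Matrix.mul_assoc, star_mul_colBlock hp, h, h', Matrix.mul_zero,
        Matrix.zero_mul, zero_add, add_zero]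
    rw [key, key, diagBlock_mul_rowBlock hp, colBlock_mul_diagBlock hp]
    congr 1
    simp only [complBlock]
    split_ifs <;> simp

theorem fromBlocks_conj_unitary {n : Type} [Fintype n] (d : Bool → A)
    (g : Matrix n n A) (u : Bool → A) [DecidableEq n] :
    fromBlocks (diagonal u) 0 0 (1 : Matrix n n A) * fromBlocks (diagonal d) 0 0 g *
      (fromBlocks (diagonal u) 0 0 (1 : Matrix n n A))ᴴ =
      fromBlocks (diagonal fun b => u b * d b * star (u b)) 0 0 g := by
  rw [fromBlocks_conjTranspose, fromBlocks_multiply, fromBlocks_multiply]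
  simp only [conjTranspose_zero, Matrix.mul_zero, Matrix.zero_mul, zero_add, add_zero,
    conjTranspose_one, Matrix.mul_one, Matrix.one_mul, diagonal_conjTranspose,
    diagonal_mul_diagonal]
  rfl

/-- A projection of rank one with commuting entries `pᵢⱼ`, and a unitary `u`, come from a
representation of `C(S_{ℂ,×})` by matrices: on one of the summands, `xᵢxⱼ*` is `pᵢⱼ` and `xⱼ*xᵢ` is
`upᵢⱼu*`. The coordinates are those on the bundles, multiplied by the adjoint of the extension of
`u` by the identity of the other summands. -/
theorem IsRankOne.exists_timesSphere (hp : IsRankOne p) (i₀ : Fin N) {u : A} (hu : u ∈ unitary A) :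
    ∃ x : Fin N → Matrix (BundleIndex N) (BundleIndex N) A, IsTimesSphere x ∧
      (∀ i j k, (x i * star (x j)) (Sum.inl false) k =
          (if k = Sum.inl false then p i j else 0) ∧
        (x i * star (x j)) k (Sum.inl false) = if k = Sum.inl false then p i j else 0) ∧
      ∀ i j k, (star (x j) * x i) (Sum.inl false) k =
          (if k = Sum.inl false then u * p i j * star u else 0) ∧
        (star (x j) * x i) k (Sum.inl false) =
          if k = Sum.inl false then u * p i j * star u else 0 := by
  let w : Bool → A := fun b => bif b then 1 else u
  let U : Matrix (BundleIndex N) (BundleIndex N) A :=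
    (fromBlocks (diagonal w) 0 0 1)
  have hw : ∀ b, w b ∈ unitary A := fun b => by
    cases b
    · exact hu
    · exact one_mem _
  have hU : U ∈ unitary (Matrix (BundleIndex N) (BundleIndex N) A) := by
    constructor
    · rw [star_eq_conjTranspose, fromBlocks_conjTranspose, fromBlocks_multiply,
        diagonal_conjTranspose, diagonal_mul_diagonal]
      simp only [Pi.star_apply, (hw _).1, conjTranspose_zero, Matrix.mul_zero, Matrix.zero_mul,
        zero_add, add_zero, conjTranspose_one, Matrix.mul_one, diagonal_one, fromBlocks_one]
    · rw [star_eq_conjTranspose, fromBlocks_conjTranspose, fromBlocks_multiply,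
        diagonal_conjTranspose, diagonal_mul_diagonal]
      simp only [Pi.star_apply, (hw _).2, conjTranspose_zero, Matrix.mul_zero, Matrix.zero_mul,
        zero_add, add_zero, conjTranspose_one, Matrix.mul_one, diagonal_one, fromBlocks_one]
  have hX := isTimesSphere_bundleCoord hp i₀
  refine ⟨fun i => bundleCoord p i₀ i * star U, hX.mul_unitary hU, fun i j k => ?_,
    fun i j k => ?_⟩
  · have h : bundleCoord p i₀ i * star U * star (bundleCoord p i₀ j * star U) =
        bundleCoord p i₀ i * star (bundleCoord p i₀ j) := by
      rw [star_mul, star_star, mul_assoc, ← mul_assoc (star U), hU.1, one_mul]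
    rw [h, bundleCoord_mul_star hp]
    rcases k with (_ | _) | k <;> simp [diagBlock, transposeIf]
  · have h : star (bundleCoord p i₀ j * star U) * (bundleCoord p i₀ i * star U) =
        U * (star (bundleCoord p i₀ j) * bundleCoord p i₀ i) * star U := by
      rw [star_mul, star_star]
      simp only [mul_assoc]
    have h2 := star_mul_bundleCoord hp i₀ i j
    rw [h, h2]
    have h3 := fromBlocks_conj_unitary (fun a => transposeIf p a i j)
      ((rowBlock p j)ᴴ * rowBlock p i + (complBlock p i₀ j)ᴴ * complBlock p i₀ i) w
    have h4 : U * (fromBlocks (diagBlock p i j) 0 0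
        ((rowBlock p j)ᴴ * rowBlock p i + (complBlock p i₀ j)ᴴ * complBlock p i₀ i)) * star U =
      (fromBlocks (diagonal fun b => w b * transposeIf p b i j * star (w b)) 0 0
        ((rowBlock p j)ᴴ * rowBlock p i + (complBlock p i₀ j)ᴴ * complBlock p i₀ i)) := h3
    rw [h4]
    rcases k with (_ | _) | k <;> simp [transposeIf, w]

end LineBundle

/-! ### The full projective versions -/

section ProjectiveVersions

open FreeStar

variable {N : ℕ}

instance (T : Set (FreeStar (Fin N))) : CStarAlgebra (fullProj T) :=
  haveI : IsClosed (fullProj T : Set (SphereAlg T)) := StarSubalgebra.isClosed_topologicalClosure _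
  StarSubalgebra.cstarAlgebra _

theorem isTimesSphere_coord_times : IsTimesSphere (coord (relTimes N)) :=
  satisfies_times_iff.mp (satisfies_univGen _)

theorem isTimesSphere_coord_star : IsTimesSphere (coord (relStar N)) :=
  isTimesSphere_of_star (satisfies_univGen _)

theorem satisfies_star_coord_starStar :
    Satisfies (freeSphereRel N ∪ relStar N) (coord (relStarStar N)) :=
  have h := satisfies_sphere_iff.mp (satisfies_univGen (freeSphereRel N ∪ relStarStar N))
  satisfies_sphere_iff.mpr ⟨h.1, h.2.star_of_starStar⟩

theorem IsTimesSphere.isRankOne_fullP {T : Set (FreeStar (Fin N))}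
    (h : IsTimesSphere (coord T)) : IsRankOne (fullP T) :=
  IsRankOne.of_coe h.isRankOne_left

theorem IsTimesSphere.isRankOne_fullQ {T : Set (FreeStar (Fin N))}
    (h : IsTimesSphere (coord T)) : IsRankOne (fullQ T) :=
  IsRankOne.of_coe h.isRankOne_right

theorem left_right_comm {A : Type} [CStarAlgebra A] {x : Fin N → A}
    (h : Satisfies (freeSphereRel N ∪ relStar N) x) (i j k l : Fin N) :
    x i * star (x j) * (star (x l) * x k) = star (x l) * x k * (x i * star (x j)) := by
  have := h _ (Or.inr ⟨_, Or.inl ⟨i, j, rfl⟩, _, Or.inr ⟨l, k, rfl⟩, rfl⟩)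
  simpa only [map_sub, map_mul, map_star, eval_gen, sub_eq_zero] using this

/-- A homomorphism to the algebra of the full projective version is onto when its range contains the
generators, since ranges are closed. -/
theorem fullProj_surjective {T : Set (FreeStar (Fin N))} {A : Type} [CStarAlgebra A]
    (φ : A →⋆ₐ[ℂ] fullProj T) (h1 : ∀ i j, ∃ a, φ a = fullP T i j)
    (h2 : ∀ i j, ∃ a, φ a = fullQ T i j) : Function.Surjective φ := by
  refine closureAdjoin_surjective φ ?_
  rintro _ (⟨i, j, rfl⟩ | ⟨i, j, rfl⟩)
  · exact (h1 i j).imp fun a ha => congrArg Subtype.val ha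
  · exact (h2 i j).imp fun a ha => congrArg Subtype.val ha

/-- The representation of `C(S_{ℂ,×})` on line bundles turns `xᵢxⱼ*` into `pᵢⱼ`, and `xⱼ*xᵢ` into
`zpᵢⱼz*`, on one of the summands. -/
theorem exists_fullProj_times_hom (i₀ : Fin N) :
    ∃ θ : fullProj (relTimes N) →⋆ₐ[ℂ] FreeProd C(CP N, ℂ) C(Circle, ℂ),
      (∀ i j, θ (fullP (relTimes N) i j) = freeInl (projCoord i j)) ∧
        ∀ i j, θ (fullQ (relTimes N) i j) = freeConj (projCoord i j) := by
  obtain ⟨x, hx, hl, hr⟩ := ((isRankOne_projCoord (N := N)).map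
    (freeInlHom C(CP N, ℂ) C(Circle, ℂ))).exists_timesSphere i₀ freeUnitary_mem
  let y : Fin N → CStarMatrix (BundleIndex N) (BundleIndex N) (FreeProd C(CP N, ℂ) C(Circle, ℂ)) :=
    fun i => CStarMatrix.ofMatrix (x i)
  have hy : IsTimesSphere y := ⟨hx.1, hx.2, hx.3⟩
  obtain ⟨Θ, hΘ⟩ := exists_univ_lift _ y (satisfies_times_iff.mpr hy)
  have h1 : ∀ i j, Θ (leftCoord (relTimes N) i j) = y i * star (y j) := fun i j => by
    rw [leftCoord, map_mul, map_star]
    exact congrArg₂ (fun a b => a * star b) (hΘ i) (hΘ j)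
  have h2 : ∀ i j, Θ (rightCoord (relTimes N) i j) = star (y j) * y i := fun i j => by
    rw [rightCoord, map_mul, map_star]
    exact congrArg₂ (fun a b => star b * a) (hΘ i) (hΘ j)
  obtain ⟨θ, hθ⟩ := exists_corner Θ (Sum.inl false)
    (s := {f | ∃ i j, f = leftCoord (relTimes N) i j} ∪
      {f | ∃ i j, f = rightCoord (relTimes N) i j}) (by
    rintro _ (⟨i, j, rfl⟩ | ⟨i, j, rfl⟩) k hk
    · rw [h1]
      have := hl i j k
      rw [if_neg hk] at this
      exact this
    · rw [h2]
      have := hr i j k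
      rw [if_neg hk] at this
      exact this)
  refine ⟨θ, fun i j => ?_, fun i j => ?_⟩
  · refine (hθ _).trans ?_
    change Θ (leftCoord (relTimes N) i j) _ _ = _
    rw [h1]
    exact ((hl i j _).1.trans (if_pos rfl))
  · refine (hθ _).trans ?_
    change Θ (rightCoord (relTimes N) i j) _ _ = _
    rw [h2]
    exact ((hr i j _).1.trans (if_pos rfl))

/-- The isomorphism between `C(P ∘ P)` and the full projective version of `S_{ℂ,×}`: the
representation on line bundles shows that it is injective. -/
theorem exists_circProd_hom : ∃ α : circProd C(CP N, ℂ) →⋆ₐ[ℂ] fullProj (relTimes N),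
    (∀ i j, α (circFst (projCoord i j)) = fullP (relTimes N) i j) ∧
      (∀ i j, α (circSnd (projCoord i j)) = fullQ (relTimes N) i j) ∧ Function.Bijective α := by
  obtain ⟨φ, hφ⟩ := (isTimesSphere_coord_times (N := N)).isRankOne_fullP.exists_lift
  obtain ⟨ψ, hψ⟩ := (isTimesSphere_coord_times (N := N)).isRankOne_fullQ.exists_lift
  obtain ⟨α, h1, h2⟩ := exists_circProd_lift φ ψ
  have h1' : ∀ i j, α (circFst (projCoord i j)) = fullP (relTimes N) i j := fun i j => by
    rw [h1, hφ]
  have h2' : ∀ i j, α (circSnd (projCoord i j)) = fullQ (relTimes N) i j := fun i j => by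
    rw [h2, hψ]
  refine ⟨α, h1', h2', ?_, fullProj_surjective α (fun i j => ⟨_, h1' i j⟩) fun i j => ⟨_, h2' i j⟩⟩
  rcases N.eq_zero_or_pos with rfl | hN
  · -- the projective space is empty, and the algebras vanish
    have h0 : (1 : C(CP 0, ℂ)) = 0 := by
      rw [← (isRankOne_projCoord (N := 0)).trace, Finset.univ_eq_empty, Finset.sum_empty]
    have h3 : (1 : circProd C(CP 0, ℂ)) = 0 := by
      rw [← map_one (circFstHom C(CP 0, ℂ)), h0, map_zero]
    exact fun a b _ => (subsingleton_of_zero_eq_one h3.symm).elim a b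
  · obtain ⟨θ, ht1, ht2⟩ := exists_fullProj_times_hom (⟨0, hN⟩ : Fin N)
    have h3 : θ.comp α = (circProd C(CP N, ℂ)).subtype :=
      circProd_projSpace_hom_ext
        (fun i j => by rw [StarAlgHom.comp_apply, h1', ht1]; rfl)
        (fun i j => by rw [StarAlgHom.comp_apply, h2', ht2]; rfl)
    intro a b hab
    refine Subtype.ext ?_
    have h4 := fun c => DFunLike.congr_fun h3 c
    exact (h4 a).symm.trans ((congrArg θ hab).trans (h4 b))

/-- In the presence of the relations of `S_{ℂ,*}`, the full projective version is a quotient of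
`C(P × P)`. -/
theorem exists_prod_hom {T : Set (FreeStar (Fin N))}
    (hT : Satisfies (freeSphereRel N ∪ relStar N) (coord T)) :
    ∃ γ : C(CP N × CP N, ℂ) →⋆ₐ[ℂ] fullProj T,
      (∀ i j, γ (tensorLeft (projCoord i j)) = fullP T i j) ∧
      (∀ i j, γ (tensorRight (projCoord i j)) = fullQ T i j) ∧ Function.Surjective γ := by
  have h := isTimesSphere_of_star hT
  obtain ⟨γ, h1, h2⟩ := h.isRankOne_fullP.exists_prod_lift h.isRankOne_fullQ
    (fun i j k l => Subtype.ext (left_right_comm hT i j k l))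
  exact ⟨γ, h1, h2, fullProj_surjective γ (fun i j => ⟨_, h1 i j⟩) fun i j => ⟨_, h2 i j⟩⟩

/-- A pair of points of the projective space defines a character of the full projective version of
`S_{ℂ,**}`. -/
theorem exists_fullProj_starStar_character (y : CP N × CP N) :
    ∃ θ : fullProj (relStarStar N) →⋆ₐ[ℂ] ℂ,
      (∀ i j, θ (fullP (relStarStar N) i j) = projCoord i j y.1) ∧
        ∀ i j, θ (fullQ (relStarStar N) i j) = projCoord i j y.2 := by
  obtain ⟨v, hv⟩ := exists_unit_vector y.1
  obtain ⟨w, hw⟩ := exists_unit_vector y.2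
  have hs : ∀ z : CP N, ∑ i, projCoord i i z = 1 := fun z => by
    rw [← ContinuousMap.sum_apply, isRankOne_projCoord.trace, ContinuousMap.one_apply]
  obtain ⟨Θ, hΘ⟩ := exists_univ_lift _ _ (satisfies_antidiag (v := v) (w := w)
    (by simp only [hv, hs]) (by simp only [hw, hs]))
  have h1 : ∀ i j k l, Θ (leftCoord (relStarStar N) i j) k l =
      if k = l then (bif k then projCoord i j y.1 else projCoord i j y.2) else 0 :=
    fun i j k l => by
      have : Θ (leftCoord (relStarStar N) i j) =
          antidiag (v i) (w i) * star (antidiag (v j) (w j)) := by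
        rw [leftCoord, map_mul, map_star]
        exact congrArg₂ (fun a b => a * star b) (hΘ i) (hΘ j)
      rw [this, star_antidiag, antidiag_mul, hv, hw]
  have h2 : ∀ i j k l, Θ (rightCoord (relStarStar N) i j) k l =
      if k = l then (bif k then projCoord i j y.2 else projCoord i j y.1) else 0 :=
    fun i j k l => by
      have : Θ (rightCoord (relStarStar N) i j) =
          star (antidiag (v j) (w j)) * antidiag (v i) (w i) := by
        rw [rightCoord, map_mul, map_star]
        exact congrArg₂ (fun a b => star b * a) (hΘ i) (hΘ j)
      rw [this, star_antidiag, antidiag_mul, mul_comm, mul_comm (star (v j)), hv, hw]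
  obtain ⟨θ, hθ⟩ := exists_corner Θ true
    (s := {f | ∃ i j, f = leftCoord (relStarStar N) i j} ∪
      {f | ∃ i j, f = rightCoord (relStarStar N) i j}) (by
    rintro _ (⟨i, j, rfl⟩ | ⟨i, j, rfl⟩) k hk
    · rw [h1, h1, if_neg hk, if_neg hk.symm]
      exact ⟨rfl, rfl⟩
    · rw [h2, h2, if_neg hk, if_neg hk.symm]
      exact ⟨rfl, rfl⟩)
  exact ⟨θ, fun i j => (hθ _).trans (h1 i j true true), fun i j => (hθ _).trans (h2 i j true true)⟩

/-- For `S_{ℂ,**}` the quotient is an isomorphism, since there is a character over each point of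
`P × P`. -/
theorem prod_hom_starStar_injective {γ : C(CP N × CP N, ℂ) →⋆ₐ[ℂ] fullProj (relStarStar N)}
    (h1 : ∀ i j, γ (tensorLeft (projCoord i j)) = fullP (relStarStar N) i j)
    (h2 : ∀ i j, γ (tensorRight (projCoord i j)) = fullQ (relStarStar N) i j) :
    Function.Injective γ := by
  intro f g hfg
  ext y
  obtain ⟨θ, ht1, ht2⟩ := exists_fullProj_starStar_character y
  have h : θ.comp γ = ContinuousMap.evalStarAlgHom ℂ ℂ y :=
    prod_hom_ext (fun i j => by rw [StarAlgHom.comp_apply, h1, ht1]; rfl)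
      (fun i j => by rw [StarAlgHom.comp_apply, h2, ht2]; rfl)
  exact (DFunLike.congr_fun h f).symm.trans ((congrArg θ hfg).trans (DFunLike.congr_fun h g))

/-- The inclusion `P × P ⊂ P ∘ P`. -/
theorem exists_prod_inclusion : ∃ ρ : circProd C(CP N, ℂ) →⋆ₐ[ℂ] C(CP N × CP N, ℂ),
    (∀ f, ρ (circFst f) = tensorLeft f) ∧ (∀ f, ρ (circSnd f) = tensorRight f) ∧
      Function.Surjective ρ := by
  obtain ⟨ρ, h1, h2⟩ := exists_circProd_lift
    (ContinuousMap.compStarAlgHom' ℂ ℂ (ContinuousMap.fst : C(CP N × CP N, CP N)))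
    (ContinuousMap.compStarAlgHom' ℂ ℂ (ContinuousMap.snd : C(CP N × CP N, CP N)))
  refine ⟨ρ, h1, h2, fun f => ?_⟩
  refine closureAdjoin_le_range (s := Set.range prodCoord) ρ ?_ ?_
  · rintro _ ⟨i | i, rfl⟩
    · exact ⟨_, h1 (projCoord i.1 i.2)⟩
    · exact ⟨_, h2 (projCoord i.1 i.2)⟩
  · rw [adjoin_range_dense prodCoord_separates]
    exact StarSubalgebra.mem_top

/-- If the relations `T'` hold on the sphere cut out by `T`, then it lies in the one cut out by
`T'`. -/
theorem exists_sphere_inclusion {T T' : Set (FreeStar (Fin N))}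
    (h : Satisfies (freeSphereRel N ∪ T') (coord T)) :
    ∃ π : SphereAlg T' →⋆ₐ[ℂ] SphereAlg T,
      (∀ i, π (coord T' i) = coord T i) ∧ Function.Surjective π := by
  obtain ⟨π, hπ⟩ := exists_univ_lift _ _ h
  exact ⟨π, hπ, univ_surjective _ π fun i => ⟨_, hπ i⟩⟩

end ProjectiveVersions

end HalfClassical

end

open HalfClassical in
/-- The full projective versions of the spheres `S_{ℂ,**} ⊂ S_{ℂ,*} ⊂ S_{ℂ,×}` are `P × P`, `P × P`
and `P ∘ P`, compatibly with the standard coordinates, with the inclusions of the spheres, and with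
the canonical inclusion `P × P ⊂ P ∘ P`. -/
theorem proposition4p2 (N : ℕ) :
    ∃ (π₁ : SphereAlg (relTimes N) →⋆ₐ[ℂ] SphereAlg (relStar N))
      (π₂ : SphereAlg (relStar N) →⋆ₐ[ℂ] SphereAlg (relStarStar N))
      (e₀ : fullProj (relTimes N) ≃⋆ₐ[ℂ] circProd C(CP N, ℂ))
      (e₁ : fullProj (relStar N) ≃⋆ₐ[ℂ] C(CP N × CP N, ℂ))
      (e₂ : fullProj (relStarStar N) ≃⋆ₐ[ℂ] C(CP N × CP N, ℂ))
      (ρ : circProd C(CP N, ℂ) →⋆ₐ[ℂ] C(CP N × CP N, ℂ)),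
      -- the inclusions of the spheres
      ((∀ i, π₁ (coord (relTimes N) i) = coord (relStar N) i) ∧ Function.Surjective π₁) ∧
      ((∀ i, π₂ (coord (relStar N) i) = coord (relStarStar N) i) ∧ Function.Surjective π₂) ∧
      -- the inclusion of `P × P` into `P ∘ P`
      ((∀ f, ρ (circFst f) = tensorLeft f) ∧ (∀ f, ρ (circSnd f) = tensorRight f) ∧
        Function.Surjective ρ) ∧
      -- the three projective versions, with their coordinates
      (∀ i j, e₀ (fullP (relTimes N) i j) = circFst (projCoord i j) ∧
        e₀ (fullQ (relTimes N) i j) = circSnd (projCoord i j)) ∧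
      (∀ i j, e₁ (fullP (relStar N) i j) = tensorLeft (projCoord i j) ∧
        e₁ (fullQ (relStar N) i j) = tensorRight (projCoord i j)) ∧
      (∀ i j, e₂ (fullP (relStarStar N) i j) = tensorLeft (projCoord i j) ∧
        e₂ (fullQ (relStarStar N) i j) = tensorRight (projCoord i j)) ∧
      -- compatibility with the inclusions
      (∀ a : fullProj (relTimes N), ∃ h : π₁ a ∈ fullProj (relStar N),
        e₁ ⟨π₁ a, h⟩ = ρ (e₀ a)) ∧
      (∀ a : fullProj (relStar N), ∃ h : π₂ a ∈ fullProj (relStarStar N),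
        e₂ ⟨π₂ a, h⟩ = e₁ a) := by
  obtain ⟨π₁, h1, h1s⟩ := exists_sphere_inclusion
    (satisfies_times_iff.mpr (isTimesSphere_coord_star (N := N)))
  obtain ⟨π₂, h2, h2s⟩ := exists_sphere_inclusion (satisfies_star_coord_starStar (N := N))
  obtain ⟨ρ, hρ1, hρ2, hρs⟩ := exists_prod_inclusion (N := N)
  obtain ⟨α, hα1, hα2, hα⟩ := exists_circProd_hom (N := N)
  obtain ⟨β, hβ1, hβ2, hβs⟩ :=
    exists_prod_hom (N := N) (T := relStar N) (satisfies_univGen (freeSphereRel N ∪ relStar N))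
  obtain ⟨γ, hγ1, hγ2, hγs⟩ := exists_prod_hom (satisfies_star_coord_starStar (N := N))
  have hγ := prod_hom_starStar_injective hγ1 hγ2
  have hl1 : ∀ i j, π₁ (leftCoord (relTimes N) i j) = leftCoord (relStar N) i j := fun i j => by
    rw [leftCoord, leftCoord, map_mul, map_star, h1, h1]
  have hr1 : ∀ i j, π₁ (rightCoord (relTimes N) i j) = rightCoord (relStar N) i j := fun i j => by
    rw [rightCoord, rightCoord, map_mul, map_star, h1, h1]
  have hl2 : ∀ i j, π₂ (leftCoord (relStar N) i j) = leftCoord (relStarStar N) i j :=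
    fun i j => by rw [leftCoord, leftCoord, map_mul, map_star, h2, h2]
  have hr2 : ∀ i j, π₂ (rightCoord (relStar N) i j) = rightCoord (relStarStar N) i j :=
    fun i j => by rw [rightCoord, rightCoord, map_mul, map_star, h2, h2]
  have c1 : (π₁.comp (StarSubalgebra.subtype _)).comp α =
      ((StarSubalgebra.subtype _).comp β).comp ρ :=
    circProd_projSpace_hom_ext
      (fun i j => by
        simp only [StarAlgHom.comp_apply, hα1, hρ1, hβ1]
        exact hl1 i j)
      (fun i j => by
        simp only [StarAlgHom.comp_apply, hα2, hρ2, hβ2]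
        exact hr1 i j)
  have c2 : (π₂.comp (StarSubalgebra.subtype _)).comp β = (StarSubalgebra.subtype _).comp γ :=
    prod_hom_ext
      (fun i j => by
        simp only [StarAlgHom.comp_apply, hβ1, hγ1]
        exact hl2 i j)
      (fun i j => by
        simp only [StarAlgHom.comp_apply, hβ2, hγ2]
        exact hr2 i j)
  -- injectivity for `S_{ℂ,*}` follows from the injectivity for the smaller `S_{ℂ,**}`
  have hβ : Function.Injective β := fun f g hfg => hγ <| Subtype.ext <|
    (DFunLike.congr_fun c2 f).symm.trans
      ((congrArg (fun a : fullProj (relStar N) => π₂ a) hfg).trans (DFunLike.congr_fun c2 g))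
  let e₀ := (StarAlgEquiv.ofBijective α hα).symm
  let e₁ := (StarAlgEquiv.ofBijective β ⟨hβ, hβs⟩).symm
  let e₂ := (StarAlgEquiv.ofBijective γ ⟨hγ, hγs⟩).symm
  have he₀ : ∀ c, e₀ (α c) = c := (StarAlgEquiv.ofBijective α hα).symm_apply_apply
  have he₁ : ∀ f, e₁ (β f) = f := (StarAlgEquiv.ofBijective β ⟨hβ, hβs⟩).symm_apply_apply
  have he₂ : ∀ f, e₂ (γ f) = f := (StarAlgEquiv.ofBijective γ ⟨hγ, hγs⟩).symm_apply_apply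
  refine ⟨π₁, π₂, e₀, e₁, e₂, ρ, ⟨h1, h1s⟩, ⟨h2, h2s⟩, ⟨hρ1, hρ2, hρs⟩, fun i j => ⟨?_, ?_⟩,
    fun i j => ⟨?_, ?_⟩, fun i j => ⟨?_, ?_⟩, fun a => ?_, fun a => ?_⟩
  · rw [← hα1, he₀]
  · rw [← hα2, he₀]
  · rw [← hβ1, he₁]
  · rw [← hβ2, he₁]
  · rw [← hγ1, he₂]
  · rw [← hγ2, he₂]
  · obtain ⟨c, rfl⟩ := hα.2 a
    have h : π₁ (α c) = β (ρ c) := DFunLike.congr_fun c1 c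
    refine ⟨h ▸ (β (ρ c)).2, ?_⟩
    rw [he₀]
    exact (congrArg e₁ (Subtype.ext h)).trans (he₁ (ρ c))
  · obtain ⟨f, rfl⟩ := hβs a
    have h : π₂ (β f) = γ f := DFunLike.congr_fun c2 f
    refine ⟨h ▸ (γ f).2, ?_⟩
    rw [he₁]
    exact (congrArg e₂ (Subtype.ext h)).trans (he₂ f)
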